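/- Let $m,p\ge 1$ and $n\ge 0$ be integers with $p\mid m$, let $\boldsymbol\mu_m\subset\mathbb C^\times$ be the group of $m$-th roots of unity, and let $W=G(m,p,n)$ be the group of all $n\times n$ monomial matrices with nonzero entries in $\boldsymbol\mu_m$ whose product lies in $\boldsymbol\mu_{m/p}$, acting on $\mathbb C^n$ with standard basis $e_1,\dots,e_n$. Let $\zeta$ be a primitive $d$-th root of unity with $d>1$, and put $V(g,\zeta)=\ker(g-\zeta)$. Let $E(W,\zeta)$ be the poset of all subspaces $V(g,\zeta)$, $g\in W$, ordered by reverse inclusion, and let $\widehat{E(W,\zeta)}$ be obtained from it by adjoining a new bottom element $\hat 0$ and a new top element $\hat 1$; its atoms are the inclusion-maximal $\zeta$-eigenspaces of $W$. Let $\ell=\ell(d)=d/\gcd(m,d)$, and let $a(d)$ be the number of the degrees $m,2m,\dots,(n-1)m,nm/p$ of $W$ that are divisible by $d$. A (colored) $\ell$-cycle is a two-line array $$\sigma=\begin{pmatrix}\sigma_1&\sigma_2&\cdots&\sigma_\ell\\ \delta_1\sigma_2&\delta_2\sigma_3&\cdots&\delta_\ell\sigma_1\end{pmatrix}$$ with distinct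 $\sigma_i\in[n]$, $\sigma_1<\sigma_2,\dots,\sigma_\ell$ and $\delta_i\in\boldsymbol\mu_m$; it is identified with the linear map $e_{\sigma_i}\mapsto\delta_ie_{\sigma_{i+1}}$ (indices modulo $\ell$) that fixes every other $e_j$. Its support is $\{\sigma_1,\dots,\sigma_\ell\}$. A word of a maximal eigenspace $E\in E(W,\zeta)$ is a sequence $$\mathrm{word}(E)=(s_1,\dots,s_{n-a(d)\ell}\,;\,\sigma^{(1)},\dots,\sigma^{(a(d))})$$ in which the $\sigma^{(i)}$ are $\ell$-cycles with pairwise disjoint supports, $E=\bigoplus_iV(\sigma^{(i)},\zeta)$, $s_1<s_2<\cdots$ are the elements of $[n]$ outside the supports of all $\sigma^{(i)}$, and $\min\mathrm{Supp}(\sigma^{(i)})<\min\mathrm{Supp}(\sigma^{(j)})$ for $i<j$. Order $\boldsymbol\mu_m$ by $\omega^j<\omega^k$ for $0\le j<k<m$, where $\omega=e^{2\pi i/m}$. Compare two distinct $\ell$-cycles at the first column in which they differ, columns being compared lexicographically by $(\sigma_k,\sigma_{k+1},\delta_k)$ (with $\sigma_{\ell+1}=\sigma_1$). Compare two distinct words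 at the first position in which they differ. For a finite graded bounded poset $P$, an ordering $a_1,\dots,a_t$ of its atoms is a recursive atom ordering if $P$ has rank $1$, or if $P$ has rank greater than $1$ and 1. for each $j$ the interval $[a_j,\hat 1]$ has a recursive atom ordering in which the atoms lying above some $a_i$ with $i<j$ come first; and 2. whenever $i<j$ and $a_i,a_j<x$, there are a $k<j$ and an atom $\tilde x$ of $[a_j,\hat 1]$ with $a_k<\tilde x\le x$. **Theorem.** Every maximal $\zeta$-eigenspace $E\in E(W,\zeta)$ has exactly one word, so that the maximal eigenspaces have a unique listing in strictly increasing lexicographic order of their words. The poset $\widehat{E(W,\zeta)}$ is finite and graded, and this listing of its atoms is a recursive atom ordering of $\widehat{E(W,\zeta)}$. -/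

import Mathlib

/-! ### The groups `G(m,p,n)` and their eigenspaces -/

/-- The monomial matrix of `e_j ↦ c_j e_{π(j)}`. -/
def monomialMatrix {n : ℕ} (π : Equiv.Perm (Fin n)) (c : Fin n → ℂ) :
    Matrix (Fin n) (Fin n) ℂ :=
  fun i j => if i = π j then c j else 0

theorem monomialMatrix_mul {n : ℕ} (π ρ : Equiv.Perm (Fin n)) (b c : Fin n → ℂ) :
    monomialMatrix π b * monomialMatrix ρ c = monomialMatrix (π * ρ) (fun j => b (ρ j) * c j) := by
  ext i j
  simp [Matrix.mul_apply, monomialMatrix]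
  rfl

theorem monomialMatrix_one {n : ℕ} :
    monomialMatrix (1 : Equiv.Perm (Fin n)) (fun _ => 1) = 1 := by
  ext i j
  simp [monomialMatrix, Matrix.one_apply]
  rfl

/-- `G(m,p,n)`: the group of all `n × n` monomial matrices whose nonzero entries are `m`-th roots
of unity and such that the product of the nonzero entries is an `(m/p)`-th root of unity. -/
def monomialGroup (m p n : ℕ) : Subgroup (GL (Fin n) ℂ) where
  carrier := {g | ∃ (π : Equiv.Perm (Fin n)) (c : Fin n → ℂ),
    (∀ i, c i ^ m = 1) ∧ (∏ i, c i) ^ (m / p) = 1 ∧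
      (g : Matrix (Fin n) (Fin n) ℂ) = monomialMatrix π c}
  mul_mem' := by
    rintro g h ⟨π, b, hb, hb', hg⟩ ⟨ρ, c, hc, hc', hh⟩
    refine ⟨π * ρ, fun j => b (ρ j) * c j, fun i => ?_, ?_, ?_⟩
    · rw [mul_pow, hb, hc, one_mul]
    · rw [Finset.prod_mul_distrib, Equiv.prod_comp ρ b, mul_pow, hb', hc', one_mul]
    · rw [Units.val_mul, hg, hh, monomialMatrix_mul]
  one_mem' := ⟨1, fun _ => 1, by simp, by simp, by rw [monomialMatrix_one]; rfl⟩
  inv_mem' := by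
    rintro g ⟨π, c, hc, hc', hg⟩
    rcases Nat.eq_zero_or_pos m with rfl | hm
    · have hd : IsUnit (g : Matrix (Fin n) (Fin n) ℂ).det :=
        (Matrix.isUnit_iff_isUnit_det _).mp g.isUnit
      have hc0 : ∀ i, c i ≠ 0 := by
        intro i hi
        apply hd.ne_zero
        apply Matrix.det_eq_zero_of_column_eq_zero i
        intro k
        simp [hg, monomialMatrix, hi]
      refine ⟨π⁻¹, fun j => (c (π⁻¹ j))⁻¹, by simp, by simp, ?_⟩
      rw [← Units.mul_eq_one_iff_inv_eq, hg, monomialMatrix_mul]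
      simp [hc0, monomialMatrix_one]
    · have hc0 : ∀ i, c i ≠ 0 := by
        intro i hi
        have := hc i
        rw [hi, zero_pow hm.ne'] at this
        exact zero_ne_one this
      refine ⟨π⁻¹, fun j => (c (π⁻¹ j))⁻¹, fun i => by rw [inv_pow, hc, inv_one], ?_, ?_⟩
      · rw [Finset.prod_inv_distrib, Equiv.prod_comp π⁻¹ c, inv_pow, hc', inv_one]
      · rw [← Units.mul_eq_one_iff_inv_eq, hg, monomialMatrix_mul]
        simp [hc0, monomialMatrix_one]

/-- The degrees `m, 2m, …, (n-1)m, nm/p` of `G(m,p,n)`. -/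
def monomialDegree (m p n : ℕ) (i : Fin n) : ℕ :=
  if (i : ℕ) + 1 = n then n * (m / p) else ((i : ℕ) + 1) * m

/-- `a(d)`: the number of degrees of `G(m,p,n)` that are divisible by `d`. -/
def numDegreesDvd (m p n d : ℕ) : ℕ :=
  (Finset.univ.filter fun i : Fin n => d ∣ monomialDegree m p n i).card

/-- `ℓ(d) = d / gcd(m,d)`, the least `s ≥ 1` such that the `s`-th power of a primitive `d`-th root
of unity is an `m`-th root of unity. -/
def cycleLength (m d : ℕ) : ℕ := d / Nat.gcd m d

/-- The `ζ`-eigenspace of a matrix acting on `ℂⁿ`. -/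
noncomputable def matEigenspace {n : ℕ} (g : Matrix (Fin n) (Fin n) ℂ) (ζ : ℂ) :
    Submodule ℂ (Fin n → ℂ) :=
  Module.End.eigenspace (Matrix.toLin' g) ζ

/-- The set of all `ζ`-eigenspaces of elements of `W`. -/
def eigenspaces {n : ℕ} (W : Subgroup (GL (Fin n) ℂ)) (ζ : ℂ) : Set (Submodule ℂ (Fin n → ℂ)) :=
  {X | ∃ g ∈ W, X = matEigenspace (g : Matrix (Fin n) (Fin n) ℂ) ζ}

/-- `E(W,ζ)`: the poset of all `ζ`-eigenspaces of elements of `W`, ordered by *reverse*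
inclusion. -/
abbrev EigenspacePoset {n : ℕ} (W : Subgroup (GL (Fin n) ℂ)) (ζ : ℂ) : Type :=
  (↥(eigenspaces W ζ))ᵒᵈ

/-- The underlying subspace of an element of `E(W,ζ)`. -/
def EigenspacePoset.space {n : ℕ} {W : Subgroup (GL (Fin n) ℂ)} {ζ : ℂ}
    (E : EigenspacePoset W ζ) : Submodule ℂ (Fin n → ℂ) :=
  (OrderDual.ofDual E).1

/-- `P̂`: the poset `P` with a new bottom and a new top element adjoined (even if `P` already has
such elements). -/
abbrev HatPoset (P : Type) : Type := WithBot (WithTop P)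

/-- The inclusion of `P` in `P̂`. -/
def toHat {P : Type} (x : P) : HatPoset P := ((x : WithTop P) : WithBot (WithTop P))

/-! ### Colored cycles and words -/

/-- A colored cycle of length `ℓ` with colors in `μ_m`, given by its two-line array
`(σ_1 ⋯ σ_ℓ ; δ_1 σ_2 ⋯ δ_ℓ σ_1)`, normalized such that `σ_1` is smaller than
`σ_2, …, σ_ℓ`. -/
@[ext] structure ColoredCycle (m n ℓ : ℕ) where
  /-- the entries `σ_i` -/
  pt : Fin ℓ → Fin n
  /-- the colors `δ_i` -/
  col : Fin ℓ → ℂ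
  pt_injective : Function.Injective pt
  col_pow : ∀ i, col i ^ m = 1
  pt_first : ∀ i j : Fin ℓ, (i : ℕ) = 0 → (j : ℕ) ≠ 0 → pt i < pt j

namespace ColoredCycle

variable {m n ℓ : ℕ}

/-- The support of a cycle. -/
def supp (σ : ColoredCycle m n ℓ) : Finset (Fin n) := Finset.univ.image σ.pt

/-- The linear map that sends `e_{σ_i}` to `δ_i e_{σ_{i+1}}` (indices modulo `ℓ`) and fixes every
other `e_j`. -/
noncomputable def matrix (σ : ColoredCycle m n ℓ) : Matrix (Fin n) (Fin n) ℂ :=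
  (∑ i, Matrix.single (σ.pt (finRotate ℓ i)) (σ.pt i) (σ.col i)) +
    ∑ j ∈ σ.suppᶜ, Matrix.single j j 1

/-- The `ζ`-eigenspace of a cycle. -/
noncomputable def eigen (σ : ColoredCycle m n ℓ) (ζ : ℂ) : Submodule ℂ (Fin n → ℂ) :=
  matEigenspace σ.matrix ζ

/-- The order on `μ_m`: `ω^j < ω^k` for `0 ≤ j < k < m`, where `ω = exp(2πi/m)`. -/
def ColorLT (m : ℕ) (δ ε : ℂ) : Prop :=
  ∃ j k : ℕ, j < k ∧ k < m ∧ δ = Complex.exp (2 * Real.pi * Complex.I / m) ^ j ∧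
    ε = Complex.exp (2 * Real.pi * Complex.I / m) ^ k

/-- The `i`-th column `(σ_i ; δ_i σ_{i+1})` of the two-line array. -/
def column (σ : ColoredCycle m n ℓ) (i : Fin ℓ) : Fin n × Fin n × ℂ :=
  (σ.pt i, σ.pt (finRotate ℓ i), σ.col i)

/-- Lexicographic comparison of two columns: first by `σ_i`, then by `σ_{i+1}`, then by `δ_i`. -/
def ColumnLT (m : ℕ) (u v : Fin n × Fin n × ℂ) : Prop :=
  u.1 < v.1 ∨ (u.1 = v.1 ∧ u.2.1 < v.2.1) ∨
    (u.1 = v.1 ∧ u.2.1 = v.2.1 ∧ ColorLT m u.2.2 v.2.2)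

/-- The lexicographic order on cycles of the same length: comparison of the first columns that
differ. -/
def LexLT (σ τ : ColoredCycle m n ℓ) : Prop :=
  ∃ k, (∀ i < k, σ.column i = τ.column i) ∧ ColumnLT m (σ.column k) (τ.column k)

end ColoredCycle

/-- A sequence `(s_1, …, s_{n-aℓ} ; σ^(1), …, σ^(a))` of elements of `[n]` followed by colored
`ℓ`-cycles. -/
@[ext] structure EigenWord (m n ℓ a : ℕ) where
  /-- the integers `s_i` -/
  fixed : Fin (n - a * ℓ) → Fin n
  /-- the cycles `σ^(i)` -/
  cycles : Fin a → ColoredCycle m n ℓ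

namespace EigenWord

variable {m n ℓ a : ℕ}

/-- `w` is a word of the subspace `E`: the cycles are disjoint, `E` is the direct sum of
their `ζ`-eigenspaces, the integers `s_1 < s_2 < ⋯` are the elements of `[n]` outside the supports
of the cycles, and the cycles are listed by increasing minimum of their supports. -/
structure IsWordOf (ζ : ℂ) (w : EigenWord m n ℓ a) (E : Submodule ℂ (Fin n → ℂ)) : Prop where
  disjoint : ∀ i j, i ≠ j → Disjoint (w.cycles i).supp (w.cycles j).supp
  indep : iSupIndep fun i => (w.cycles i).eigen ζ
  sum_eq : E = ⨆ i, (w.cycles i).eigen ζ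
  range_fixed : Set.range w.fixed = {x | ∀ i, x ∉ (w.cycles i).supp}
  fixed_strictMono : StrictMono w.fixed
  cycles_sorted : ∀ i j, i < j → (w.cycles i).supp.min < (w.cycles j).supp.min

/-- The lexicographic order on words: comparison of the first terms that differ. -/
def LexLT (w w' : EigenWord m n ℓ a) : Prop :=
  (∃ i, (∀ i' < i, w.fixed i' = w'.fixed i') ∧ w.fixed i < w'.fixed i) ∨
    (w.fixed = w'.fixed ∧
      ∃ j, (∀ j' < j, w.cycles j' = w'.cycles j') ∧ (w.cycles j).LexLT (w'.cycles j))

end EigenWord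

/-- `es` lists the inclusion-maximal `ζ`-eigenspaces of `G(m,p,n)` (the minimal elements of the
poset of `ζ`-eigenspaces) in strictly increasing lexicographic order of their words, where `d` is
the order of `ζ`. -/
def IsLexListing (m p n d : ℕ) (ζ : ℂ)
    (es : List (EigenspacePoset (monomialGroup m p n) ζ)) : Prop :=
  (∀ E, E ∈ es ↔ IsMin E) ∧
    es.Pairwise fun E E' =>
      ∃ w w' : EigenWord m n (cycleLength m d) (numDegreesDvd m p n d),
        w.IsWordOf ζ E.space ∧ w'.IsWordOf ζ E'.space ∧ w.LexLT w'

/-! ### Recursive atom orderings -/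

/-- A bounded poset is graded if it has a rank function with values in `ℕ` that vanishes at the
bottom and increases by one along each covering relation (used for finite posets). -/
def IsGradedPoset (P : Type) [PartialOrder P] [OrderBot P] : Prop :=
  ∃ r : P → ℕ, r ⊥ = 0 ∧ ∀ x y : P, x ⋖ y → r y = r x + 1

/-- `IsRAOFrom x l`: the list `l` is a recursive atom ordering of the interval `[x, ⊤]`.
The atoms of that interval are the elements that cover `x`, and it has rank one if and only if `⊤`
covers `x`. -/
inductive IsRAOFrom {P : Type} [PartialOrder P] [OrderTop P] : P → List P → Prop
  | rank_one {x : P} (h : x ⋖ ⊤) : IsRAOFrom x [⊤]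
  | rank_gt_one {x : P} {l : List P}
      (ne_top : x ≠ ⊤) (not_covBy : ¬ x ⋖ ⊤)
      (nodup : l.Nodup) (mem_iff : ∀ a, a ∈ l ↔ x ⋖ a)
      -- a recursive atom ordering of each `[a_j, ⊤]` …
      (sub : Fin l.length → List P)
      (sub_rao : ∀ j, IsRAOFrom (l.get j) (sub j))
      -- … in which the atoms that lie above some `a_i` with `i < j` come first
      (sub_first : ∀ (j : Fin l.length) (s t : Fin (sub j).length),
        (∃ i < j, l.get i ≤ (sub j).get s) → (¬ ∃ i < j, l.get i ≤ (sub j).get t) → s < t)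
      (exchange : ∀ i j : Fin l.length, i < j → ∀ y : P, l.get i < y → l.get j < y →
        ∃ k < j, ∃ z : P, l.get j ⋖ z ∧ l.get k < z ∧ z ≤ y) :
      IsRAOFrom x l

/-- The list `l` is a recursive atom ordering of the (finite, graded) bounded poset `P`. -/
structure IsRecursiveAtomOrdering (P : Type) [PartialOrder P] [BoundedOrder P]
    (l : List P) : Prop where
  finite : Finite P
  graded : IsGradedPoset P
  rao : IsRAOFrom (⊥ : P) l

/-! If `c j * x j = ζ * x (π j)` with every `c j` in μ_m, then going from j to π j divides the m-th
power of the entry by ζ^m, whose order is exactly ℓ. The m-th powers therefore mark positions modulo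
ℓ, and the support of an eigenspace splits into blocks of ℓ coordinates. Comparison with the degrees
bounds the number of blocks by a(d), and a(d) disjoint blocks can always be realized. So the maximal
eigenspaces are sums of a(d) lines, one on each of a(d) disjoint blocks
(`IsMonomialEigenspace.exists_le_space`, `BlockFrame.isMonomialEigenspace`), and all have dimension
a(d). The same marking shows that a coordinate c in the support of such an E admits only one u and
one δ with δ x_c = ζ x_u on E (`EigenWord.IsFullWordOf.succ_unique`); this makes the word unique.

Above the atoms, reflections govern the poset. The section of an eigenspace by x_i = κ x_j, or by
x_i = 0 if m ≠ p, is again an eigenspace: multiply the group element by a reflection and use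
unitarity. Conversely, some such hyperplane separates any two strictly nested eigenspaces
(`IsMonomialEigenspace.exists_hyperplane`). Hence covers are hyperplane sections, codimension gives
the rank, and the intervals above the atoms are semimodular. There every ordering of the atoms is
recursive, so only the exchange condition at the bottom depends on the words.

For the exchange condition (`EigenspacePoset.exists_exchange`), let F precede E and let X lie in
both. The first difference of the two words names an element of G(m,1,n), which normalizes G(m,p,n),
and a reflecting hyperplane H containing X but not E, such that the element fixes E ∩ H pointwise.
It carries E to a maximal eigenspace E' whose word takes over the entry of F at that place and
agrees with the word of E before it. So E' precedes E, and E ∩ H is the required cover of E below X.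
-/

/-! ### Eigenspaces of monomial matrices in coordinates -/

/-- `X` is the `ζ`-eigenspace of an element of `G(m,p,n)`, in coordinates. -/
def IsMonomialEigenspace (m p : ℕ) {n : ℕ} (ζ : ℂ) (X : Submodule ℂ (Fin n → ℂ)) : Prop :=
  ∃ (π : Equiv.Perm (Fin n)) (c : Fin n → ℂ), (∀ i, c i ^ m = 1) ∧ (∏ i, c i) ^ (m / p) = 1 ∧
    ∀ x, x ∈ X ↔ ∀ j, c j * x j = ζ * x (π j)

theorem monomialMatrix_mulVec {n : ℕ} (π : Equiv.Perm (Fin n)) (c x : Fin n → ℂ) (j : Fin n) :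
    (monomialMatrix π c).mulVec x (π j) = c j * x j := by
  simp [Matrix.mulVec, dotProduct, monomialMatrix, π.injective.eq_iff]

theorem mem_matEigenspace_monomialMatrix {n : ℕ} (π : Equiv.Perm (Fin n)) (c x : Fin n → ℂ)
    (ζ : ℂ) : x ∈ matEigenspace (monomialMatrix π c) ζ ↔ ∀ j, c j * x j = ζ * x (π j) := by
  rw [matEigenspace, Module.End.mem_eigenspace_iff, Matrix.toLin'_apply, funext_iff,
    ← π.forall_congr_right]
  simp [monomialMatrix_mulVec]

theorem ne_zero_of_pow_eq_one {m : ℕ} (hm : 0 < m) {c : ℂ} (hc : c ^ m = 1) : c ≠ 0 := by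
  rintro rfl
  simp [hm.ne'] at hc

theorem mem_eigenspaces_iff {m p n : ℕ} (hm : 0 < m) (ζ : ℂ) (X : Submodule ℂ (Fin n → ℂ)) :
    X ∈ eigenspaces (monomialGroup m p n) ζ ↔ IsMonomialEigenspace m p ζ X := by
  constructor
  · rintro ⟨g, ⟨π, c, hc, hc', hg⟩, rfl⟩
    exact ⟨π, c, hc, hc', fun x => by rw [hg, mem_matEigenspace_monomialMatrix]⟩
  · rintro ⟨π, c, hc, hc', hX⟩
    have h0 : ∀ i, c i ≠ 0 := fun i => ne_zero_of_pow_eq_one hm (hc i)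
    let g : GL (Fin n) ℂ := ⟨monomialMatrix π c,
      monomialMatrix π⁻¹ (fun j => (c (π⁻¹ j))⁻¹),
      by rw [monomialMatrix_mul]; simp [h0, monomialMatrix_one],
      by rw [monomialMatrix_mul]; simp [h0, monomialMatrix_one]⟩
    refine ⟨g, ⟨π, c, hc, hc', rfl⟩, ?_⟩
    ext x
    rw [hX, ← mem_matEigenspace_monomialMatrix]

/-- The linear map `x ↦ (b_j x_{τ j})_j`. -/
def scalePerm {n : ℕ} (τ : Equiv.Perm (Fin n)) (b : Fin n → ℂ) :
    (Fin n → ℂ) →ₗ[ℂ] (Fin n → ℂ) where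
  toFun x j := b j * x (τ j)
  map_add' x y := by ext j; simp [mul_add]
  map_smul' r x := by ext j; simp; ring

@[simp] theorem scalePerm_apply {n : ℕ} (τ : Equiv.Perm (Fin n)) (b x : Fin n → ℂ) (j : Fin n) :
    scalePerm τ b x j = b j * x (τ j) := rfl

theorem scalePerm_injective {n : ℕ} {τ : Equiv.Perm (Fin n)} {b : Fin n → ℂ}
    (hb : ∀ i, b i ≠ 0) : Function.Injective (scalePerm τ b) := by
  intro x y h
  ext j
  have := congrFun h (τ⁻¹ j)
  simpa [hb] using this

/-- `G(m,1,n)` normalizes `G(m,p,n)`. -/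
theorem IsMonomialEigenspace.comap_scalePerm {m p n : ℕ} (hm : 0 < m) {ζ : ℂ}
    {X : Submodule ℂ (Fin n → ℂ)} (hX : IsMonomialEigenspace m p ζ X)
    (τ : Equiv.Perm (Fin n)) {b : Fin n → ℂ} (hb : ∀ i, b i ^ m = 1) :
    IsMonomialEigenspace m p ζ (X.comap (scalePerm τ b)) := by
  obtain ⟨π, c, hc, hc', hX⟩ := hX
  have hb0 : ∀ i, b i ≠ 0 := fun i => ne_zero_of_pow_eq_one hm (hb i)
  -- Conjugation changes the entries by the factors b_k / b_{π k}, which cancel in the product of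
  -- all entries.
  refine ⟨τ * π * τ⁻¹, fun k => c (τ⁻¹ k) * b (τ⁻¹ k) / b (π (τ⁻¹ k)), fun i => ?_, ?_, ?_⟩
  · rw [div_pow, mul_pow, hc, hb, hb]; simp
  · rw [Equiv.prod_comp τ⁻¹ (fun k => c k * b k / b (π k)), Finset.prod_div_distrib,
      Finset.prod_mul_distrib, Equiv.prod_comp π b, mul_div_assoc, div_self, mul_one, hc']
    exact Finset.prod_ne_zero_iff.mpr fun i _ => hb0 i
  · intro x
    rw [Submodule.mem_comap, hX, ← τ.forall_congr_right (q := fun k =>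
      c (τ⁻¹ k) * b (τ⁻¹ k) / b (π (τ⁻¹ k)) * x k = ζ * x ((τ * π * τ⁻¹) k))]
    refine forall_congr' fun j => ?_
    simp only [scalePerm_apply, Equiv.Perm.mul_apply, Equiv.Perm.inv_def,
      Equiv.symm_apply_apply]
    rw [div_mul_eq_mul_div, div_eq_iff (hb0 _)]
    constructor <;> intro h <;> linear_combination h

/-! ### Sections of eigenspaces by reflecting hyperplanes -/

theorem conj_eq_inv_of_pow_eq_one {m : ℕ} (hm : 0 < m) {c : ℂ} (hc : c ^ m = 1) :
    (starRingEnd ℂ) c = c⁻¹ := by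
  have h1 : ‖c‖ = 1 := Complex.norm_eq_one_of_pow_eq_one hc hm.ne'
  rw [Complex.inv_def, Complex.normSq_eq_norm_sq, h1]; simp

/-- The image of `g - ζ` is orthogonal to the `ζ`-eigenspace of a unitary monomial matrix `g`. -/
theorem sum_conj_mul_eq_zero {m d n : ℕ} (hm : 0 < m) (hd : 0 < d) {ζ : ℂ} (hζ : ζ ^ d = 1)
    {π : Equiv.Perm (Fin n)} {c x : Fin n → ℂ} (hc : ∀ i, c i ^ m = 1)
    (hx : ∀ j, c j * x j = ζ * x (π j)) (v : Fin n → ℂ) :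
    ∑ k, (starRingEnd ℂ) (x (π k)) * (c k * v k - ζ * v (π k)) = 0 := by
  have key : ∀ k, (starRingEnd ℂ) (x (π k)) * (c k * v k) = ζ * ((starRingEnd ℂ) (x k) * v k) := by
    intro k
    have h := congrArg (starRingEnd ℂ) (hx k)
    rw [map_mul, map_mul, conj_eq_inv_of_pow_eq_one hm (hc k),
      conj_eq_inv_of_pow_eq_one hd hζ] at h
    have h0 := ne_zero_of_pow_eq_one hm (hc k)
    have h1 := ne_zero_of_pow_eq_one hd hζ
    field_simp at h
    linear_combination (-v k) * h
  simp only [mul_sub, Finset.sum_sub_distrib, key]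
  rw [← Finset.mul_sum, ← Equiv.sum_comp π (fun k => (starRingEnd ℂ) (x k) * v k), Finset.mul_sum,
    ← Finset.sum_sub_distrib]
  exact Finset.sum_eq_zero fun k _ => by ring

/-- The functional `x ↦ x_i - κ x_j`. -/
def diffFunctional {n : ℕ} (i j : Fin n) (κ : ℂ) : (Fin n → ℂ) →ₗ[ℂ] ℂ :=
  LinearMap.proj i - κ • LinearMap.proj j

@[simp] theorem diffFunctional_apply {n : ℕ} (i j : Fin n) (κ : ℂ) (x : Fin n → ℂ) :
    diffFunctional i j κ x = x i - κ * x j := rfl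

/-- Multiply g by the reflection r in the hyperplane. If r g v = ζ v, then (g - ζ) v is a multiple
of the root of r, and it is orthogonal to x₀. Since x₀ is off the hyperplane, it is not orthogonal
to the root, so (g - ζ) v = 0 and v is fixed by r. -/
theorem IsMonomialEigenspace.inf_ker_diff {m p d n : ℕ} (hm : 0 < m) (hd : 0 < d) {ζ : ℂ}
    (hζ : ζ ^ d = 1) {X : Submodule ℂ (Fin n → ℂ)} (hX : IsMonomialEigenspace m p ζ X)
    {i j : Fin n} (hij : i ≠ j) {κ : ℂ} (hκ : κ ^ m = 1) {x₀ : Fin n → ℂ} (hx₀ : x₀ ∈ X)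
    (hne : x₀ i ≠ κ * x₀ j) :
    IsMonomialEigenspace m p ζ (X ⊓ LinearMap.ker (diffFunctional i j κ)) := by
  obtain ⟨π, c, hc, hc', hX⟩ := hX
  have hκ0 := ne_zero_of_pow_eq_one hm hκ
  have hζ0 := ne_zero_of_pow_eq_one hd hζ
  -- The entries of the reflection; κ⁻¹ and κ cancel in the product, so r g stays in G(m,p,n).
  let u : Fin n → ℂ := fun k => if k = i then κ⁻¹ else if k = j then κ else 1
  refine ⟨Equiv.swap i j * π, fun k => c k * u (π k), fun k => ?_, ?_, ?_⟩
  · rw [mul_pow, hc, one_mul]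
    simp only [u]
    split_ifs <;> simp [hκ]
  · rw [Finset.prod_mul_distrib, Equiv.prod_comp π u]
    have : ∏ k, u k = 1 := by
      rw [Finset.prod_eq_mul i j hij (fun k _ hk => by simp [u, hk.1, hk.2]) (by simp) (by simp)]
      simp [u, hij.symm, hκ0]
    rw [this, mul_one, hc']
  · intro v
    simp only [Submodule.mem_inf, hX, LinearMap.mem_ker, diffFunctional_apply,
      Equiv.Perm.mul_apply]
    obtain ⟨ki, rfl⟩ := π.surjective i
    obtain ⟨kj, rfl⟩ := π.surjective j
    have hk : ki ≠ kj := fun h => hij (by rw [h])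
    constructor
    · rintro ⟨hv, hv'⟩ k
      by_cases h1 : k = ki
      · subst h1
        simp only [u, if_true, Equiv.swap_apply_left]
        have := hv k
        field_simp
        linear_combination this + ζ * hv'
      by_cases h2 : k = kj
      · subst h2
        simp only [u, hij.symm, if_true, if_false, Equiv.swap_apply_right]
        linear_combination κ * hv k - ζ * hv'
      have h1' : π k ≠ π ki := fun h => h1 (π.injective h)
      have h2' : π k ≠ π kj := fun h => h2 (π.injective h)
      simp [u, h1', h2', Equiv.swap_apply_of_ne_of_ne, hv k]
    · intro hv
      have hi := hv ki
      have hj := hv kj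
      simp only [u, hij.symm, if_true, if_false, Equiv.swap_apply_right,
        Equiv.swap_apply_left] at hi hj
      have hrest : ∀ k, k ≠ ki → k ≠ kj → c k * v k = ζ * v (π k) := by
        intro k h1 h2
        have h1' : π k ≠ π ki := fun h => h1 (π.injective h)
        have h2' : π k ≠ π kj := fun h => h2 (π.injective h)
        have := hv k
        simpa [u, h1', h2', Equiv.swap_apply_of_ne_of_ne] using this
      -- Only the two coordinates moved by r contribute to the pairing of x₀ with (g - ζ) v.
      have hsum := sum_conj_mul_eq_zero hm hd hζ hc ((hX x₀).mp hx₀) v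
      rw [Finset.sum_eq_add ki kj hk (fun k _ h => by rw [hrest k h.1 h.2]; simp) (by simp)
        (by simp)] at hsum
      have hi' : c ki * v ki = ζ * κ * v (π kj) := by
        field_simp at hi
        linear_combination hi
      have hj' : c kj * v kj = ζ * κ⁻¹ * v (π ki) := by
        field_simp
        linear_combination hj
      rw [hi', hj'] at hsum
      have hv0 : v (π ki) - κ * v (π kj) = 0 := by
        by_contra h
        apply hne
        have h3 : ζ * (v (π ki) - κ * v (π kj)) *
            (κ⁻¹ * (starRingEnd ℂ) (x₀ (π kj)) - (starRingEnd ℂ) (x₀ (π ki))) = 0 := by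
          rw [← hsum]
          field_simp
          ring
        have h4 := (mul_eq_zero.mp h3).resolve_left (mul_ne_zero hζ0 h)
        have h5 := congrArg (starRingEnd ℂ) h4
        rw [← conj_eq_inv_of_pow_eq_one hm hκ] at h5
        simp only [map_sub, map_mul, Complex.conj_conj, map_zero] at h5
        linear_combination -h5
      refine ⟨fun k => ?_, hv0⟩
      by_cases h1 : k = ki
      · subst h1
        rw [hi']; linear_combination -ζ * hv0
      by_cases h2 : k = kj
      · subst h2
        rw [hj']
        field_simp
        linear_combination hv0
      exact hrest k h1 h2

/-- The argument of `inf_ker_diff` with a diagonal reflection. It belongs to the group because its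
nontrivial eigenvalue can be taken of order m/p, which exceeds 1. -/
theorem IsMonomialEigenspace.inf_ker_proj {m p d n : ℕ} (hm : 0 < m) (hd : 0 < d) (hp : p ∣ m)
    (hpm : m ≠ p) {ζ : ℂ}
    (hζ : ζ ^ d = 1) {X : Submodule ℂ (Fin n → ℂ)} (hX : IsMonomialEigenspace m p ζ X)
    {i : Fin n} {x₀ : Fin n → ℂ} (hx₀ : x₀ ∈ X) (hne : x₀ i ≠ 0) :
    IsMonomialEigenspace m p ζ (X ⊓ LinearMap.ker (LinearMap.proj i)) := by
  obtain ⟨π, c, hc, hc', hX⟩ := hX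
  obtain ⟨q, rfl⟩ := hp
  have hp0 : 0 < p := Nat.pos_of_mul_pos_right hm
  have hq0 : 0 < q := Nat.pos_of_mul_pos_left hm
  rw [Nat.mul_div_cancel_left _ hp0] at hc'
  have hε := Complex.isPrimitiveRoot_exp q hq0.ne'
  set ε := Complex.exp (2 * Real.pi * Complex.I / q)
  have hε1 : ε ≠ 1 := hε.ne_one (by
    rcases Nat.lt_or_ge 1 q with h | h
    · exact h
    · exact absurd (by rw [show q = 1 by omega, mul_one]) hpm)
  let u : Fin n → ℂ := fun k => if k = i then ε else 1
  refine ⟨π, fun k => c k * u (π k), fun k => ?_, ?_, ?_⟩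
  · rw [mul_pow, hc, one_mul]
    simp only [u]
    split_ifs
    · rw [mul_comm, pow_mul, hε.pow_eq_one, one_pow]
    · simp
  · rw [Nat.mul_div_cancel_left _ hp0, Finset.prod_mul_distrib, Equiv.prod_comp π u, mul_pow, hc',
      one_mul]
    simp [u, hε.pow_eq_one]
  · intro v
    simp only [Submodule.mem_inf, hX, LinearMap.mem_ker, LinearMap.proj_apply]
    obtain ⟨ki, rfl⟩ := π.surjective i
    have hcki := ne_zero_of_pow_eq_one hm (hc ki)
    constructor
    · rintro ⟨hv, hv'⟩ k
      by_cases h1 : k = ki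
      · subst h1
        have := hv k
        rw [hv', mul_zero, mul_eq_zero, or_iff_right hcki] at this
        simp [this, hv']
      have h1' : π k ≠ π ki := fun h => h1 (π.injective h)
      simp [u, h1', hv k]
    · intro hv
      have hi := hv ki
      simp only [u, if_true] at hi
      have hrest : ∀ k, k ≠ ki → c k * v k = ζ * v (π k) := by
        intro k h1
        have h1' : π k ≠ π ki := fun h => h1 (π.injective h)
        have := hv k
        simpa [u, h1'] using this
      have hsum := sum_conj_mul_eq_zero hm hd hζ hc ((hX x₀).mp hx₀) v
      rw [Finset.sum_eq_single ki (fun k _ h => by rw [hrest k h]; simp) (by simp)] at hsum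
      have h2 := sub_eq_zero.mp ((mul_eq_zero.mp hsum).resolve_left (by simpa using hne))
      refine ⟨fun k => ?_, ?_⟩
      · by_cases h1 : k = ki
        · rw [h1, h2]
        · exact hrest k h1
      · rw [← h2] at hi
        have h3 : c ki * v ki * (ε - 1) = 0 := by linear_combination hi
        rw [mul_eq_zero, or_iff_left (sub_ne_zero.mpr hε1)] at h3
        rw [h3] at h2
        exact (mul_eq_zero.mp h2.symm).resolve_left (ne_zero_of_pow_eq_one hd hζ)

/-- A subspace of `ℂⁿ` contains a vector that vanishes only where the whole subspace does. -/
theorem exists_mem_forall_ne_zero {n : ℕ} (X : Submodule ℂ (Fin n → ℂ)) :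
    ∃ x ∈ X, ∀ i, (∃ y ∈ X, y i ≠ 0) → x i ≠ 0 := by
  have key : ∀ s : Finset (Fin n), ∃ x ∈ X, ∀ i ∈ s, (∃ y ∈ X, y i ≠ 0) → x i ≠ 0 := by
    intro s
    induction s using Finset.induction_on with
    | empty => exact ⟨0, X.zero_mem, by simp⟩
    | insert a s ha ih =>
      obtain ⟨x, hx, hxs⟩ := ih
      by_cases h : (∃ y ∈ X, y a ≠ 0) ∧ x a = 0
      · obtain ⟨⟨y, hy, hya⟩, hxa⟩ := h
        -- A generic multiple of y: t ≠ 0 makes coordinate a nonzero, and avoiding the values -x_i /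
        -- y_i keeps the earlier coordinates nonzero.
        obtain ⟨t, ht⟩ := Set.Infinite.exists_notMem_finset
          (Set.infinite_univ.sdiff (Set.finite_singleton (0 : ℂ))) (s.image fun i => - x i / y i)
        refine ⟨x + t • y, X.add_mem hx (X.smul_mem _ hy), fun i hi hi' => ?_⟩
        rcases Finset.mem_insert.mp hi with rfl | hi
        · simpa [hxa, hya] using ht.1
        · intro h0
          simp only [Pi.add_apply, Pi.smul_apply, smul_eq_mul] at h0
          by_cases hyi : y i = 0
          · rw [hyi, mul_zero, add_zero] at h0
            exact hxs i hi hi' h0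
          · refine ht.2 (Finset.mem_image.mpr ⟨i, hi, ?_⟩)
            rw [div_eq_iff hyi]
            linear_combination -h0
      · refine ⟨x, hx, fun i hi hi' => ?_⟩
        rcases Finset.mem_insert.mp hi with rfl | hi
        · exact fun h0 => h ⟨hi', h0⟩
        · exact hxs i hi hi'
  obtain ⟨x, hx, h⟩ := key Finset.univ
  exact ⟨x, hx, fun i => h i (Finset.mem_univ i)⟩

/-- If `Y ⊊ X` are eigenspaces, then a reflecting hyperplane contains `Y` but not `X`. -/
theorem IsMonomialEigenspace.exists_hyperplane {m p d n : ℕ} (hm : 0 < m) (hd : 0 < d)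
    (hp : p ∣ m) {ζ : ℂ} (hζ : ζ ^ d = 1) {X Y : Submodule ℂ (Fin n → ℂ)}
    (hX : IsMonomialEigenspace m p ζ X) (hY : IsMonomialEigenspace m p ζ Y) (hYX : Y < X) :
    (∃ i j κ, i ≠ j ∧ κ ^ m = 1 ∧ (∀ y ∈ Y, y i = κ * y j) ∧ ∃ x ∈ X, x i ≠ κ * x j) ∨
      (m ≠ p ∧ ∃ i, (∀ y ∈ Y, y i = 0) ∧ ∃ x ∈ X, x i ≠ 0) := by
  obtain ⟨π, c, hc, hc', hX⟩ := hX
  obtain ⟨ρ, b, hb, hb', hY⟩ := hY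
  have hζ0 := ne_zero_of_pow_eq_one hd hζ
  have hc0 : ∀ i, c i ≠ 0 := fun i => ne_zero_of_pow_eq_one hm (hc i)
  by_contra hcon
  rw [not_or] at hcon
  obtain ⟨hcon, hcon'⟩ := hcon
  -- If the permutations differ at j, the two equations give y (ρ j) = (b_j / c_j) y (π j) on Y. By
  -- `hcon` this persists on X, so X satisfies the j-th equation of Y as well.
  have hdiff : ∀ j, ρ j ≠ π j → ∀ x ∈ X, b j * x j = ζ * x (ρ j) := by
    intro j hj x hx
    by_contra h
    apply hcon
    refine ⟨ρ j, π j, b j / c j, hj, by rw [div_pow, hb, hc, div_one], fun y hy => ?_, x, hx, ?_⟩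
    · have h1 := (hY y).mp hy j
      have h2 := (hX y).mp (hYX.le hy) j
      have h3 := hc0 j
      field_simp
      apply mul_left_cancel₀ hζ0
      linear_combination b j * h2 - c j * h1
    · intro h1
      apply h
      have h2 := (hX x).mp hx j
      have h3 := hc0 j
      have h4 : c j * (ζ * (b j / c j * x (π j))) = b j * (ζ * x (π j)) := by field_simp
      apply mul_left_cancel₀ h3
      rw [h1, h4, ← h2]
      ring
  obtain ⟨x, hx, hxY⟩ := SetLike.exists_of_lt hYX
  rw [hY] at hxY
  push Not at hxY
  obtain ⟨j, hj⟩ := hxY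
  -- An equation of Y that fails on X must involve the same permutation value but a different color;
  -- then Y vanishes at π j.
  have hρj : ρ j = π j := by
    by_contra h
    exact hj (hdiff j h x hx)
  have hbc : b j ≠ c j := by
    intro h
    apply hj
    rw [h, hρj]
    exact (hX x).mp hx j
  have hxi : x (π j) ≠ 0 := by
    intro h
    apply hj
    have := (hX x).mp hx j
    rw [h, mul_zero, mul_eq_zero, or_iff_right (hc0 j)] at this
    rw [hρj, h, this]; simp
  have hYi : ∀ y ∈ Y, y (π j) = 0 := by
    intro y hy
    have h1 := (hY y).mp hy j
    have h2 := (hX y).mp (hYX.le hy) j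
    rw [hρj] at h1
    have h3 : (b j - c j) * y j = 0 := by linear_combination h1 - h2
    rw [mul_eq_zero, or_iff_right (sub_ne_zero.mpr hbc)] at h3
    rw [h3, mul_zero] at h1
    exact (mul_eq_zero.mp h1.symm).resolve_left hζ0
  have hmp : m = p := by
    by_contra h
    exact hcon' ⟨h, π j, hYi, x, hx, hxi⟩
  subst hmp
  rw [Nat.div_self hm, pow_one] at hb' hc'
  -- If Y vanishes at a second coordinate i, then `hcon` applies to x_{π j} = κ x_i for both κ = b_j
  -- and κ = c_j. As these differ, x would vanish at π j.
  by_cases hall : ∃ i, i ≠ π j ∧ ∀ y ∈ Y, y i = 0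
  · obtain ⟨i, hi, hi'⟩ := hall
    have hzero : ∀ κ : ℂ, κ ^ m = 1 → x (π j) = κ * x i := by
      intro κ hκ
      by_contra h
      exact hcon ⟨π j, i, κ, hi.symm, hκ, fun y hy => by rw [hYi y hy, hi' y hy, mul_zero], x, hx,
        h⟩
    have h1 := hzero _ (hb j)
    have h2 := hzero _ (hc j)
    have h3 : (b j - c j) * x i = 0 := by linear_combination h2 - h1
    rw [mul_eq_zero, or_iff_right (sub_ne_zero.mpr hbc)] at h3
    rw [h3, mul_zero] at h1
    exact hxi h1
  · push Not at hall
    -- Otherwise X contains a vector z without zero entries that satisfies all equations of Y except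
    -- possibly the j-th. Since m = p, both matrices have product of entries 1, and multiplying the
    -- equations yields the j-th one too, so b_j = c_j.
    obtain ⟨z, hz, hz'⟩ := exists_mem_forall_ne_zero X
    have hz0 : ∀ i, z i ≠ 0 := by
      intro i
      apply hz'
      by_cases h : i = π j
      · exact ⟨x, hx, h ▸ hxi⟩
      · obtain ⟨y, hy, hy'⟩ := hall i h
        exact ⟨y, hYX.le hy, hy'⟩
    have hbz : ∀ k, k ≠ j → b k * z k = ζ * z (ρ k) := by
      intro k hk
      by_cases h : ρ k = π k
      · have hk' : ρ k ≠ π j := fun h' => hk (ρ.injective (h'.trans hρj.symm))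
        obtain ⟨y, hy, hy'⟩ := hall _ hk'
        have h1 := (hY y).mp hy k
        have h2 := (hX y).mp (hYX.le hy) k
        rw [← h] at h2
        have h3 : (b k - c k) * y k = 0 := by linear_combination h1 - h2
        rcases mul_eq_zero.mp h3 with h4 | h4
        · rw [sub_eq_zero.mp h4, h]
          exact (hX z).mp hz k
        · rw [h4, mul_zero] at h1
          exact absurd ((mul_eq_zero.mp h1.symm).resolve_left hζ0) hy'
      · exact hdiff k h z hz
    have hcz := (hX z).mp hz
    have hb1 : ∏ k ∈ Finset.univ.erase j, (b k * z k) =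
        ∏ k ∈ Finset.univ.erase j, (ζ * z (ρ k)) :=
      Finset.prod_congr rfl fun k hk => hbz k (Finset.ne_of_mem_erase hk)
    have hfull : (∏ k, (b k * z k)) * (ζ * z (ρ j)) = (∏ k, (ζ * z (ρ k))) * (b j * z j) := by
      rw [← Finset.mul_prod_erase _ _ (Finset.mem_univ j),
        ← Finset.mul_prod_erase _ (fun k => ζ * z (ρ k)) (Finset.mem_univ j), hb1]
      ring
    have hprod : ∏ k, (b k * z k) = ∏ k, (ζ * z (ρ k)) := by
      have : ∏ k, (c k * z k) = ∏ k, (ζ * z (π k)) := Finset.prod_congr rfl fun k _ => hcz k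
      simp only [Finset.prod_mul_distrib, hb', hc', Equiv.prod_comp π z, Equiv.prod_comp ρ z]
        at this ⊢
      exact this
    rw [hprod] at hfull
    have h0 : ∏ k, (ζ * z (ρ k)) ≠ 0 :=
      Finset.prod_ne_zero_iff.mpr fun k _ => mul_ne_zero hζ0 (hz0 _)
    have h1 := mul_left_cancel₀ h0 hfull
    rw [hρj, ← hcz j] at h1
    exact hbc (mul_right_cancel₀ (hz0 j) h1).symm

/-! ### Counting the degrees divisible by d -/

theorem cycleLength_pos {m d : ℕ} (hd : 0 < d) : 0 < cycleLength m d :=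
  Nat.div_pos (Nat.le_of_dvd hd (Nat.gcd_dvd_right m d)) (Nat.gcd_pos_of_pos_right m hd)

theorem isPrimitiveRoot_pow_cycleLength {m d : ℕ} (hd : 0 < d) {ζ : ℂ}
    (hζ : IsPrimitiveRoot ζ d) : IsPrimitiveRoot (ζ ^ m) (cycleLength m d) := by
  have h : orderOf (ζ ^ m) = cycleLength m d := by
    have hfin : IsOfFinOrder ζ := isOfFinOrder_iff_pow_eq_one.mpr ⟨d, hd, hζ.pow_eq_one⟩
    rw [hfin.orderOf_pow, ← hζ.eq_orderOf, cycleLength, Nat.gcd_comm]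
  rw [← h]
  exact IsPrimitiveRoot.orderOf _

theorem dvd_mul_iff_cycleLength_dvd {m d : ℕ} (hd : 0 < d) (k : ℕ) :
    d ∣ k * m ↔ cycleLength m d ∣ k := by
  have hζ := Complex.isPrimitiveRoot_exp d hd.ne'
  rw [← hζ.pow_eq_one_iff_dvd, ← (isPrimitiveRoot_pow_cycleLength hd hζ).pow_eq_one_iff_dvd,
    ← pow_mul, mul_comm m k]

theorem cycleLength_dvd_of_dvd_monomialDegree {m p n d : ℕ} (hd : 0 < d) (hp : p ∣ m)
    {i : Fin n} (h : d ∣ monomialDegree m p n i) : cycleLength m d ∣ (i : ℕ) + 1 := by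
  rw [← dvd_mul_iff_cycleLength_dvd hd]
  unfold monomialDegree at h
  split_ifs at h with hi
  · rw [hi]
    exact h.trans (Nat.mul_dvd_mul_left n (Nat.div_dvd_of_dvd hp))
  · exact h

/-- A degree divisible by d has an index i + 1 that is a multiple of ℓ, so at most N/ℓ of them
occur. The bound N = n limits the number of blocks; N = n - 1 is the case in which d does not divide
the last degree nm/p. -/
theorem numDegreesDvd_le {m p n d : ℕ} (hd : 0 < d) (hp : p ∣ m) (N : ℕ)
    (hN : ∀ i : Fin n, d ∣ monomialDegree m p n i → (i : ℕ) + 1 ≤ N) :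
    numDegreesDvd m p n d * cycleLength m d ≤ N := by
  have hℓ := cycleLength_pos (m := m) hd
  rw [← Nat.le_div_iff_mul_le hℓ, numDegreesDvd, ← Finset.card_range (N / cycleLength m d)]
  refine Finset.card_le_card_of_injOn (fun i => ((i : ℕ) + 1) / cycleLength m d - 1) ?_ ?_
  · intro i hi
    simp only [Finset.coe_filter, Finset.mem_univ, true_and, Set.mem_ofPred_eq] at hi
    obtain ⟨k, hk⟩ := cycleLength_dvd_of_dvd_monomialDegree hd hp hi
    have h1 := hN i hi
    have h2 : k ≠ 0 := by rintro rfl; simp at hk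
    simp only [Finset.coe_range, Set.mem_Iio]
    rw [hk] at h1 ⊢
    rw [Nat.mul_div_cancel_left _ hℓ]
    have : k ≤ N / cycleLength m d := (Nat.le_div_iff_mul_le hℓ).mpr (by rwa [mul_comm])
    omega
  · intro i hi j hj hij
    simp only [Finset.coe_filter, Finset.mem_univ, true_and, Set.mem_ofPred_eq] at hi hj
    obtain ⟨k, hk⟩ := cycleLength_dvd_of_dvd_monomialDegree hd hp hi
    obtain ⟨k', hk'⟩ := cycleLength_dvd_of_dvd_monomialDegree hd hp hj
    have h2 : k ≠ 0 := by rintro rfl; simp at hk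
    have h2' : k' ≠ 0 := by rintro rfl; simp at hk'
    simp only [hk, hk', Nat.mul_div_cancel_left _ hℓ] at hij
    have : k = k' := by omega
    subst this
    ext
    omega

theorem numDegreesDvd_mul_le {m p n d : ℕ} (hd : 0 < d) (hp : p ∣ m) :
    numDegreesDvd m p n d * cycleLength m d ≤ n :=
  numDegreesDvd_le hd hp n fun i _ => i.2

theorem dvd_of_numDegreesDvd_mul_eq {m p n d : ℕ} (hd : 0 < d) (hp : p ∣ m)
    (h : numDegreesDvd m p n d * cycleLength m d = n) : d ∣ n * (m / p) := by
  by_contra hcon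
  have hn : n ≠ 0 := by rintro rfl; simp at hcon
  have := numDegreesDvd_le (m := m) (p := p) (n := n) hd hp (n - 1) fun i hi => by
    have h1 : (i : ℕ) + 1 ≠ n := by
      intro h1
      rw [monomialDegree, if_pos h1] at hi
      exact hcon hi
    have := i.2
    omega
  omega

/-- The multiples of ℓ up to K ℓ index degrees divisible by d. Only the last degree nm/p can fail,
and it is among them exactly when K ℓ = n; hence the extra condition. -/
theorem le_numDegreesDvd {m p n d K : ℕ} (hd : 0 < d) (hK : K * cycleLength m d ≤ n)
    (h : K * cycleLength m d = n → d ∣ n * (m / p)) : K ≤ numDegreesDvd m p n d := by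
  have hℓ := cycleLength_pos (m := m) hd
  rw [numDegreesDvd]
  have hle : ∀ k : Fin K, ((k : ℕ) + 1) * cycleLength m d ≤ n := fun k =>
    (Nat.mul_le_mul_right _ k.2).trans hK
  have hpos : ∀ k : Fin K, 0 < ((k : ℕ) + 1) * cycleLength m d := fun k =>
    Nat.mul_pos (Nat.succ_pos _) hℓ
  have hlt : ∀ k : Fin K, ((k : ℕ) + 1) * cycleLength m d - 1 < n := fun k => by
    have := hle k; have := hpos k; omega
  conv_lhs => rw [← Finset.card_fin K]
  refine Finset.card_le_card_of_injOn (fun k => ⟨((k : ℕ) + 1) * cycleLength m d - 1, hlt k⟩) ?_ ?_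
  · intro k _
    simp only [Finset.coe_filter, Finset.mem_univ, true_and, Set.mem_ofPred_eq]
    rw [monomialDegree]
    simp only [Nat.sub_add_cancel (hpos k)]
    split_ifs with h1
    · apply h
      apply le_antisymm hK
      calc n = ((k : ℕ) + 1) * cycleLength m d := h1.symm
        _ ≤ _ := Nat.mul_le_mul_right _ k.2
    · rw [dvd_mul_iff_cycleLength_dvd hd]
      exact dvd_mul_left _ _
  · intro i _ j _ hij
    simp only [Fin.mk.injEq] at hij
    have h1 := hpos i
    have h2 := hpos j
    have h3 : ((i : ℕ) + 1) * cycleLength m d = ((j : ℕ) + 1) * cycleLength m d := by omega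
    have := Nat.eq_of_mul_eq_mul_right hℓ h3
    ext
    omega

/-- If the maximal eigenspaces do not have full support, then the entry `ζ^{-aℓ}` in the
complement of the support creates no further eigenvector. -/
theorem not_dvd_numDegreesDvd_mul_add_one {m p n d : ℕ} (hd : 1 < d)
    (h : numDegreesDvd m p n d * cycleLength m d < n) :
    ¬ d ∣ numDegreesDvd m p n d * cycleLength m d + 1 := by
  intro hdvd
  have hd0 : 0 < d := by omega
  -- ℓ divides d, hence both a ℓ + 1 and a ℓ. With ℓ = 1, all degrees but the last are divisible by
  -- d, so a = n - 1 and d ∣ n; but then the last degree is divisible too.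
  have h1 : cycleLength m d ∣ 1 :=
    (Nat.dvd_add_right (dvd_mul_left _ _)).mp
      ((Nat.div_dvd_of_dvd (Nat.gcd_dvd_right m d)).trans hdvd)
  rw [Nat.dvd_one] at h1
  rw [h1, mul_one] at h hdvd
  have h2 : n - 1 ≤ numDegreesDvd m p n d :=
    le_numDegreesDvd hd0 (by rw [h1]; omega) (by rw [h1]; omega)
  have h3 : numDegreesDvd m p n d + 1 = n := by omega
  rw [h3] at hdvd
  have h4 : n ≤ numDegreesDvd m p n d :=
    le_numDegreesDvd hd0 (by rw [h1, mul_one]) fun _ => hdvd.mul_right _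
  omega

/-! ### Sums of lines supported on disjoint blocks -/

theorem pow_finRotate {ℓ : ℕ} {w : ℂ} (hw : w ^ ℓ = 1) (s : Fin ℓ) :
    w ^ (finRotate ℓ s : ℕ) = w ^ ((s : ℕ) + 1) := by
  obtain ⟨k, rfl⟩ : ∃ k, ℓ = k + 1 := ⟨ℓ - 1, by have := s.2; omega⟩
  rw [finRotate_apply, Fin.val_add, Fin.val_one', Nat.add_mod_mod, ← pow_eq_pow_mod _ hw]

theorem finRotate_mk {ℓ k : ℕ} (hk : k + 1 < ℓ) :
    finRotate ℓ ⟨k, by omega⟩ = ⟨k + 1, hk⟩ := by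
  obtain ⟨q, rfl⟩ : ∃ q, ℓ = q + 1 := ⟨ℓ - 1, by omega⟩
  exact finRotate_of_lt (by omega)

/-- Disjoint blocks of `ℓ` coordinates, together with a vector whose entries `x_s` on each block
satisfy `x_s ^ m = ζ ^ (-s m)`. -/
structure BlockFrame (m n ℓ : ℕ) (ζ : ℂ) (J : Type) where
  /-- the entries of the blocks -/
  pt : J → Fin ℓ → Fin n
  pt_injective : Function.Injective fun x : J × Fin ℓ => pt x.1 x.2
  /-- the vector -/
  val : Fin n → ℂ
  val_ne_zero : ∀ i, val i ≠ 0
  val_pow : ∀ j (s : Fin ℓ), (ζ ^ m) ^ (s : ℕ) * val (pt j s) ^ m = 1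

namespace BlockFrame

variable {m n ℓ : ℕ} {ζ : ℂ} {J : Type}

/-- The sum of the lines spanned by the restrictions of the vector to the blocks. -/
def space (F : BlockFrame m n ℓ ζ J) : Submodule ℂ (Fin n → ℂ) where
  carrier := {x | (∀ i, (∀ j s, F.pt j s ≠ i) → x i = 0) ∧
    ∀ j s t, F.val (F.pt j t) * x (F.pt j s) = F.val (F.pt j s) * x (F.pt j t)}
  add_mem' {x y} hx hy := ⟨fun i hi => by simp [hx.1 i hi, hy.1 i hi], fun j s t => by
    simp only [Pi.add_apply]; linear_combination hx.2 j s t + hy.2 j s t⟩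
  zero_mem' := by simp
  smul_mem' r x hx := ⟨fun i hi => by simp [hx.1 i hi], fun j s t => by
    simp only [Pi.smul_apply, smul_eq_mul]; linear_combination r * hx.2 j s t⟩

theorem mem_space {F : BlockFrame m n ℓ ζ J} {x : Fin n → ℂ} : x ∈ F.space ↔
    (∀ i, (∀ j s, F.pt j s ≠ i) → x i = 0) ∧
    ∀ j s t, F.val (F.pt j t) * x (F.pt j s) = F.val (F.pt j s) * x (F.pt j t) := Iff.rfl

/-- These quotients are the colors that make the vector a ζ-eigenvector of the block rotation. The
m-th power of the entry drops by ζ^m at each step, and the wrap-around is consistent because ζ^m has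
ℓ-th power 1. -/
theorem val_mul_pow (F : BlockFrame m n ℓ ζ J) (hζ : (ζ ^ m) ^ ℓ = 1) (j : J) (s : Fin ℓ) :
    (ζ * F.val (F.pt j (finRotate ℓ s)) / F.val (F.pt j s)) ^ m = 1 := by
  have h1 := F.val_pow j s
  have h2 := F.val_pow j (finRotate ℓ s)
  rw [pow_finRotate hζ, pow_succ] at h2
  have h3 : ((ζ ^ m) ^ (s : ℕ)) ≠ 0 := by
    intro h; rw [h, zero_mul] at h1; exact zero_ne_one h1
  rw [div_pow, mul_pow, div_eq_one_iff_eq (pow_ne_zero _ (F.val_ne_zero _))]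
  apply mul_left_cancel₀ h3
  linear_combination h2 - h1

/-- The embedding of `ℂ^J` in `ℂⁿ` with image `space`. -/
noncomputable def embed (F : BlockFrame m n ℓ ζ J) : (J → ℂ) →ₗ[ℂ] (Fin n → ℂ) where
  toFun u := Function.extend (fun x : J × Fin ℓ => F.pt x.1 x.2)
    (fun x => F.val (F.pt x.1 x.2) * u x.1) 0
  map_add' u v := by
    ext i
    by_cases h : ∃ x : J × Fin ℓ, F.pt x.1 x.2 = i
    · obtain ⟨x, rfl⟩ := h
      simp only [Pi.add_apply, F.pt_injective.extend_apply (a := x), mul_add]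
    · simp [Function.extend_apply' _ _ _ h]
  map_smul' r u := by
    ext i
    by_cases h : ∃ x : J × Fin ℓ, F.pt x.1 x.2 = i
    · obtain ⟨x, rfl⟩ := h
      simp only [Pi.smul_apply, F.pt_injective.extend_apply (a := x), smul_eq_mul, RingHom.id_apply]
      ring
    · simp [Function.extend_apply' _ _ _ h]

theorem embed_apply (F : BlockFrame m n ℓ ζ J) (u : J → ℂ) (j : J) (s : Fin ℓ) :
    F.embed u (F.pt j s) = F.val (F.pt j s) * u j :=
  F.pt_injective.extend_apply (fun x => F.val (F.pt x.1 x.2) * u x.1) 0 (j, s)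

theorem embed_apply_of_forall_ne (F : BlockFrame m n ℓ ζ J) (u : J → ℂ) (i : Fin n)
    (hi : ∀ j s, F.pt j s ≠ i) : F.embed u i = 0 := by
  have h : ¬ ∃ x : J × Fin ℓ, F.pt x.1 x.2 = i := by rintro ⟨x, hx⟩; exact hi _ _ hx
  exact Function.extend_apply' (fun x : J × Fin ℓ => F.val (F.pt x.1 x.2) * u x.1) (0 : Fin n → ℂ) i h

theorem embed_injective (hℓ : 0 < ℓ) (F : BlockFrame m n ℓ ζ J) :
    Function.Injective F.embed := by
  intro u v h
  ext j
  have := congrFun h (F.pt j ⟨0, hℓ⟩)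
  rw [embed_apply, embed_apply] at this
  exact mul_left_cancel₀ (F.val_ne_zero _) this

theorem range_embed (hℓ : 0 < ℓ) (F : BlockFrame m n ℓ ζ J) :
    LinearMap.range F.embed = F.space := by
  ext x
  constructor
  · rintro ⟨u, rfl⟩
    refine ⟨F.embed_apply_of_forall_ne u, fun j s t => ?_⟩
    rw [embed_apply, embed_apply]; ring
  · rintro ⟨hx, hx'⟩
    refine ⟨fun j => x (F.pt j ⟨0, hℓ⟩) / F.val (F.pt j ⟨0, hℓ⟩), ?_⟩
    ext i
    by_cases h : ∃ j s, F.pt j s = i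
    · obtain ⟨j, s, rfl⟩ := h
      rw [embed_apply, mul_div_assoc', div_eq_iff (F.val_ne_zero _)]
      linear_combination - hx' j s ⟨0, hℓ⟩
    · push Not at h
      rw [F.embed_apply_of_forall_ne _ _ h, hx i h]

theorem finrank_space [Fintype J] (hℓ : 0 < ℓ) (F : BlockFrame m n ℓ ζ J) :
    Module.finrank ℂ F.space = Fintype.card J := by
  rw [← F.range_embed hℓ, LinearMap.finrank_range_of_inj (F.embed_injective hℓ),
    Module.finrank_fintype_fun_eq_card]

/-- Proportionality on a block can be checked along consecutive entries. -/
theorem forall_of_step (F : BlockFrame m n ℓ ζ J) (j : J) (x : Fin n → ℂ)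
    (hstep : ∀ s, F.val (F.pt j (finRotate ℓ s)) * x (F.pt j s) =
      F.val (F.pt j s) * x (F.pt j (finRotate ℓ s))) (s t : Fin ℓ) :
    F.val (F.pt j t) * x (F.pt j s) = F.val (F.pt j s) * x (F.pt j t) := by
  have hℓ0 : 0 < ℓ := s.pos
  have hzero : ∀ (k : ℕ) (hk : k < ℓ), F.val (F.pt j ⟨0, hℓ0⟩) * x (F.pt j ⟨k, hk⟩) =
      F.val (F.pt j ⟨k, hk⟩) * x (F.pt j ⟨0, hℓ0⟩) := by
    intro k
    induction k with
    | zero => intro _; rfl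
    | succ k ih =>
      intro hk
      have h1 := hstep ⟨k, by omega⟩
      rw [finRotate_mk hk] at h1
      apply mul_left_cancel₀ (F.val_ne_zero (F.pt j ⟨k, by omega⟩))
      linear_combination F.val (F.pt j ⟨k + 1, hk⟩) * ih (by omega) -
        F.val (F.pt j ⟨0, hℓ0⟩) * h1
  apply mul_left_cancel₀ (F.val_ne_zero (F.pt j ⟨0, hℓ0⟩))
  linear_combination F.val (F.pt j t) * hzero s s.2 - F.val (F.pt j s) * hzero t t.2

/-- Rotate each block, with the colors forced by the vector; their product telescopes to ζ^ℓ on each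
block. If a coordinate is left over, one diagonal entry ζ^(-aℓ) repairs the product, and it differs
from ζ, so no eigenvector is added. If none is left, then a ℓ = n and d divides nm/p, so the product
ζ^n is already admissible. -/
theorem isMonomialEigenspace [Fintype J] {p d : ℕ} (hd : 1 < d) (hp : p ∣ m)
    (hζ : IsPrimitiveRoot ζ d) (hℓ : ℓ = cycleLength m d) (F : BlockFrame m n ℓ ζ J)
    (hJ : Fintype.card J = numDegreesDvd m p n d) : IsMonomialEigenspace m p ζ F.space := by
  classical
  have hd0 : 0 < d := by omega
  have hζ0 : ζ ≠ 0 := hζ.ne_zero (by omega)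
  have hw := isPrimitiveRoot_pow_cycleLength (m := m) hd0 hζ
  rw [← hℓ] at hw
  set a := numDegreesDvd m p n d with ha
  let f : J × Fin ℓ ↪ Fin n := ⟨fun x => F.pt x.1 x.2, F.pt_injective⟩
  let π : Equiv.Perm (Fin n) :=
    Equiv.Perm.viaFintypeEmbedding (Equiv.prodCongr (Equiv.refl J) (finRotate ℓ)) f
  have hπ : ∀ j s, π (F.pt j s) = F.pt j (finRotate ℓ s) := fun j s =>
    Equiv.Perm.viaFintypeEmbedding_apply_image _ f (j, s)
  have hπ' : ∀ i, (∀ j s, F.pt j s ≠ i) → π i = i := fun i hi =>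
    Equiv.Perm.viaFintypeEmbedding_apply_notMem_range _ f
      (by rintro ⟨x, hx⟩; exact hi _ _ hx)
  let S : Finset (Fin n) := Finset.univ.map f
  have hS : ∀ i, i ∉ S ↔ ∀ j s, F.pt j s ≠ i := by
    intro i; simp [S, f]
  have hScard : S.card = a * ℓ := by simp [S, hJ]
  have hprodS : ∀ c : Fin n → ℂ, ∏ i ∈ S, c i = ∏ j, ∏ s, c (F.pt j s) := fun c => by
    rw [Finset.prod_map, Fintype.prod_prod_type]; rfl
  -- a diagonal entry off the support that makes the product of all entries trivial
  obtain ⟨e, he, heζ, hee⟩ : ∃ e : Fin n → ℂ, (∀ i, e i ^ m = 1) ∧ (∀ i, i ∉ S → e i ≠ ζ) ∧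
      (ζ ^ (a * ℓ) * ∏ i ∈ Sᶜ, e i) ^ (m / p) = 1 := by
    by_cases h : ∃ i₀, i₀ ∉ S
    · obtain ⟨i₀, hi₀⟩ := h
      have hlt : a * ℓ < n := by
        rw [← hScard]
        calc S.card < (insert i₀ S).card := by rw [Finset.card_insert_of_notMem hi₀]; omega
          _ ≤ n := by simpa using Finset.card_le_univ (insert i₀ S)
      have hnd := not_dvd_numDegreesDvd_mul_add_one (m := m) (p := p) hd (hℓ ▸ hlt)
      rw [← hℓ] at hnd
      refine ⟨fun i => if i = i₀ then (ζ ^ (a * ℓ))⁻¹ else 1, fun i => ?_, fun i _ => ?_, ?_⟩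
      · dsimp only
        split_ifs
        · have : (ζ ^ (a * ℓ)) ^ m = ((ζ ^ m) ^ ℓ) ^ a := by
            rw [← pow_mul, ← pow_mul, ← pow_mul]; congr 1; ring
          rw [inv_pow, this, hw.pow_eq_one, one_pow, inv_one]
        · simp
      · dsimp only
        split_ifs
        · intro h
          apply hnd
          rw [← hζ.pow_eq_one_iff_dvd, pow_succ]
          nth_rewrite 2 [← h]
          exact mul_inv_cancel₀ (pow_ne_zero _ hζ0)
        · exact (hζ.ne_one hd).symm
      · rw [Finset.prod_ite_eq' Sᶜ i₀, if_pos (by simpa using hi₀),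
          mul_inv_cancel₀ (pow_ne_zero _ hζ0), one_pow]
    · push Not at h
      have hSu : S = Finset.univ := by ext i; simp [h i]
      refine ⟨fun _ => 1, by simp, fun i hi => absurd (h i) hi, ?_⟩
      have han : a * ℓ = n := by rw [← hScard, hSu]; simp
      have := dvd_of_numDegreesDvd_mul_eq (m := m) (p := p) hd0 hp (hℓ ▸ han)
      simp only [Finset.prod_const_one, mul_one, han]
      rw [← pow_mul, hζ.pow_eq_one_iff_dvd]
      exact this
  let c : Fin n → ℂ := fun i => if i ∈ S then ζ * F.val (π i) / F.val i else e i
  have hcS : ∀ j s, c (F.pt j s) = ζ * F.val (F.pt j (finRotate ℓ s)) / F.val (F.pt j s) := by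
    intro j s
    have : F.pt j s ∈ S := by
      by_contra h
      exact (hS _).mp h j s rfl
    simp [c, this, hπ]
  have hcS' : ∀ i, i ∉ S → c i = e i := fun i hi => by simp [c, hi]
  refine ⟨π, c, fun i => ?_, ?_, fun x => ?_⟩
  · by_cases h : i ∈ S
    · obtain ⟨⟨j, s⟩, -, rfl⟩ := Finset.mem_map.mp h
      change c (F.pt j s) ^ m = 1
      rw [hcS]
      exact F.val_mul_pow hw.pow_eq_one j s
    · rw [hcS' i h, he]
  · have h1 : ∏ i ∈ S, c i = ζ ^ (a * ℓ) := by
      rw [hprodS, pow_mul', ← hJ, ← Finset.card_univ, ← Finset.prod_const]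
      refine Finset.prod_congr rfl fun j _ => ?_
      simp only [hcS, Finset.prod_div_distrib, Finset.prod_mul_distrib, Finset.prod_const,
        Finset.card_univ, Fintype.card_fin]
      rw [Equiv.prod_comp (finRotate ℓ) (fun s => F.val (F.pt j s)), mul_div_assoc, div_self,
        mul_one]
      exact Finset.prod_ne_zero_iff.mpr fun s _ => F.val_ne_zero _
    rw [← Finset.prod_mul_prod_compl S c, h1,
      Finset.prod_congr rfl fun i hi => hcS' i (by simpa using hi), hee]
  · rw [mem_space]
    constructor
    · rintro ⟨hx, hx'⟩ i
      by_cases h : i ∈ S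
      · obtain ⟨⟨j, s⟩, -, rfl⟩ := Finset.mem_map.mp h
        change c (F.pt j s) * x (F.pt j s) = ζ * x (π (F.pt j s))
        rw [hcS, hπ, div_mul_eq_mul_div, div_eq_iff (F.val_ne_zero _)]
        linear_combination ζ * hx' j s (finRotate ℓ s)
      · have h' := (hS i).mp h
        rw [hπ' i h', hx i h']; simp
    · intro hx
      refine ⟨fun i hi => ?_, fun j => ?_⟩
      · have h1 := hx i
        have hiS := (hS i).mpr hi
        rw [hπ' i hi, hcS' i hiS] at h1
        have h2 : (e i - ζ) * x i = 0 := by linear_combination h1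
        exact (mul_eq_zero.mp h2).resolve_left (sub_ne_zero.mpr (heζ i hiS))
      · have hstep : ∀ s, F.val (F.pt j (finRotate ℓ s)) * x (F.pt j s) =
            F.val (F.pt j s) * x (F.pt j (finRotate ℓ s)) := by
          intro s
          have h1 := hx (F.pt j s)
          rw [hcS, hπ, div_mul_eq_mul_div, div_eq_iff (F.val_ne_zero _)] at h1
          apply mul_left_cancel₀ hζ0
          linear_combination h1
        exact F.forall_of_step j x hstep

end BlockFrame

/-! ### Every eigenspace lies in a sum of a(d) block lines -/

/-- An eigenspace of a monomial matrix contains a vector that vanishes only where the whole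
eigenspace does and whose other entries are roots of unity. -/
theorem exists_root_of_unity_vector {m d n : ℕ} (hm : 0 < m) (hd : 0 < d) {ζ : ℂ}
    (hζ : ζ ^ d = 1) {X : Submodule ℂ (Fin n → ℂ)} {π : Equiv.Perm (Fin n)} {c : Fin n → ℂ}
    (hc : ∀ i, c i ^ m = 1) (hX : ∀ x, x ∈ X ↔ ∀ j, c j * x j = ζ * x (π j)) :
    ∃ y ∈ X, (∀ i, y i = 0 → ∀ x ∈ X, x i = 0) ∧
      ∀ i, y i ≠ 0 → ∃ k : ℕ, (ζ ^ m) ^ k * y i ^ m = 1 := by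
  obtain ⟨z, hz, hz'⟩ := exists_mem_forall_ne_zero X
  have hζ0 := ne_zero_of_pow_eq_one hd hζ
  have hc0 : ∀ i, c i ≠ 0 := fun i => ne_zero_of_pow_eq_one hm (hc i)
  let rep : Fin n → Fin n := fun i => (Quotient.mk (Equiv.Perm.SameCycle.setoid π) i).out
  have hrep : ∀ i, π.SameCycle (rep i) i := fun i =>
    Quotient.exact (s := Equiv.Perm.SameCycle.setoid π) (Quotient.out_eq _)
  have hrepπ : ∀ i, rep (π i) = rep i := fun i => by
    have : Quotient.mk (Equiv.Perm.SameCycle.setoid π) (π i) =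
        Quotient.mk (Equiv.Perm.SameCycle.setoid π) i :=
      Quotient.sound (s := Equiv.Perm.SameCycle.setoid π)
        (Equiv.Perm.sameCycle_apply_left.mpr (Equiv.Perm.SameCycle.refl π i))
    simp only [rep, this]
  have hzπ : ∀ i, z (π i) = 0 ↔ z i = 0 := fun i => by
    have h := (hX z).mp hz i
    constructor
    · intro h'
      rw [h', mul_zero] at h
      exact (mul_eq_zero.mp h).resolve_left (hc0 i)
    · intro h'
      rw [h', mul_zero] at h
      exact (mul_eq_zero.mp h.symm).resolve_left hζ0
  have hpow : ∀ (k : ℕ) i, z ((π ^ k) i) = 0 ↔ z i = 0 := by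
    intro k i
    induction k with
    | zero => rfl
    | succ k ih => rw [pow_succ', Equiv.Perm.mul_apply, hzπ, ih]
  have hzrep : ∀ i, z (rep i) = 0 ↔ z i = 0 := fun i => by
    obtain ⟨k, hk⟩ := (hrep i).exists_nat_pow_eq
    rw [← hpow k, hk]
  -- Dividing by the value at a chosen representative of each cycle of π keeps z an eigenvector and
  -- makes its entry 1 there; the other m-th powers are then powers of ζ^(-m).
  let y : Fin n → ℂ := fun i => z i / z (rep i)
  have hyX : y ∈ X := by
    rw [hX]
    intro j
    simp only [y, hrepπ]
    rw [mul_div_assoc', (hX z).mp hz j, mul_div_assoc]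
  refine ⟨y, hyX, fun i hi x hx => ?_, fun i hi => ?_⟩
  · by_contra h
    have h1 := hz' i ⟨x, hx, h⟩
    exact div_ne_zero h1 (fun h2 => h1 ((hzrep i).mp h2)) hi
  · obtain ⟨k, hk⟩ := (hrep i).exists_nat_pow_eq
    have hr : z (rep i) ≠ 0 := fun h => hi (by simp [y, h])
    have hyr : y (rep i) = 1 := by
      have : rep (rep i) = rep i := by simp only [rep, Quotient.out_eq]
      simp only [y, this, div_self hr]
    refine ⟨k, ?_⟩
    rw [← hk]
    clear hk hi
    induction k with
    | zero => simp [hyr]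
    | succ k ih =>
      have h := congrArg (· ^ m) ((hX y).mp hyX ((π ^ k) (rep i)))
      simp only [mul_pow, hc, one_mul] at h
      rw [pow_succ' π, Equiv.Perm.mul_apply, pow_succ, mul_assoc, ← h, ih]

/-- The vector y of the previous lemma cuts its support into blocks: each starts at an index with
y_i^m = 1 and follows π for ℓ steps. There are at most a(d) of them, and arbitrary blocks on zero
coordinates of y bring the number up to a(d). -/
theorem IsMonomialEigenspace.exists_le_space {m p d n ℓ : ℕ} (hm : 0 < m) (hp : p ∣ m) (hd : 1 < d)
    {ζ : ℂ} (hζ : IsPrimitiveRoot ζ d) (hℓ : ℓ = cycleLength m d)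
    {X : Submodule ℂ (Fin n → ℂ)} (hX : IsMonomialEigenspace m p ζ X) :
    ∃ F : BlockFrame m n ℓ ζ (Fin (numDegreesDvd m p n d)), X ≤ F.space := by
  classical
  obtain ⟨π, c, hc, hc', hX⟩ := hX
  have hd0 : 0 < d := by omega
  have hζ0 : ζ ≠ 0 := hζ.ne_zero (by omega)
  have hw := isPrimitiveRoot_pow_cycleLength (m := m) hd0 hζ
  have hℓ0 : 0 < ℓ := hℓ ▸ cycleLength_pos hd0
  rw [← hℓ] at hw
  obtain ⟨y, hyX, hy0, hyk⟩ := exists_root_of_unity_vector hm hd0 hζ.pow_eq_one hc hX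
  have hyc := (hX y).mp hyX
  have hpow : ∀ (s : ℕ) i, (ζ ^ m) ^ s * y ((π ^ s) i) ^ m = y i ^ m := by
    intro s i
    induction s with
    | zero => simp
    | succ s ih =>
      have h := congrArg (· ^ m) (hyc ((π ^ s) i))
      simp only [mul_pow, hc, one_mul] at h
      rw [pow_succ' π, Equiv.Perm.mul_apply, pow_succ, mul_assoc, ← h, ih]
  have hne : ∀ (s : ℕ) i, y i ≠ 0 → y ((π ^ s) i) ≠ 0 := by
    intro s i hi h
    have := hpow s i
    rw [h, zero_pow hm.ne', mul_zero] at this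
    exact hi (pow_eq_zero_iff hm.ne' |>.mp this.symm)
  let J₀ := {i : Fin n // y i ≠ 0 ∧ y i ^ m = 1}
  let f : J₀ × Fin ℓ → Fin n := fun x => (π ^ (x.2 : ℕ)) x.1.1
  -- The m-th power of y after s steps is ζ^(-sm), which determines s < ℓ; then the starting point
  -- is determined as well.
  have hf : Function.Injective f := by
    rintro ⟨j, s⟩ ⟨j', s'⟩ h
    have h1 := hpow s j.1
    have h2 := hpow s' j'.1
    change (π ^ (s : ℕ)) j.1 = (π ^ (s' : ℕ)) j'.1 at h
    rw [j.2.2] at h1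
    rw [j'.2.2, ← h] at h2
    have h3 := mul_right_cancel₀ (pow_ne_zero m (hne s j.1 j.2.1)) (h2.trans h1.symm)
    have h4 : (s' : ℕ) = s := hw.pow_inj s'.2 s.2 h3
    have h5 : s' = s := Fin.ext h4
    subst h5
    have h6 : j = j' := Subtype.ext ((π ^ (s' : ℕ)).injective h)
    rw [h6]
  have hcover : ∀ i, y i ≠ 0 → ∃ x, f x = i := by
    intro i hi
    obtain ⟨k, hk⟩ := hyk i hi
    rw [pow_eq_pow_mod k hw.pow_eq_one] at hk
    have h1 := hpow (k % ℓ) ((π ^ (k % ℓ)).symm i)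
    rw [Equiv.apply_symm_apply, hk] at h1
    have h2 : y ((π ^ (k % ℓ)).symm i) ≠ 0 := fun h => by
      rw [h, zero_pow hm.ne'] at h1
      exact one_ne_zero h1
    exact ⟨(⟨(π ^ (k % ℓ)).symm i, h2, h1.symm⟩, ⟨k % ℓ, Nat.mod_lt _ hℓ0⟩),
      Equiv.apply_symm_apply _ _⟩
  have hfne : ∀ x, y (f x) ≠ 0 := fun x => hne _ _ x.1.2.1
  set a := numDegreesDvd m p n d with ha
  set K := Fintype.card J₀ with hK
  have hKn : K * ℓ ≤ n := by simpa [hK] using Fintype.card_le_of_injective f hf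
  have hKa : K ≤ a := by
    -- If the blocks exhaust all coordinates, multiplying all eigenvector equations of y gives ∏ c =
    -- ζ^n, and the condition on ∏ c becomes d ∣ n(m/p).
    refine le_numDegreesDvd hd0 (hℓ ▸ hKn) fun h => ?_
    have hsurj : Function.Surjective f :=
      ((Fintype.bijective_iff_injective_and_card f).mpr ⟨hf, by simp [← hK, hℓ, h]⟩).2
    have hy : ∀ i, y i ≠ 0 := fun i => by
      obtain ⟨x, rfl⟩ := hsurj i
      exact hfne x
    have h1 : ∏ i, (c i * y i) = ∏ i, (ζ * y (π i)) := Finset.prod_congr rfl fun i _ => hyc i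
    rw [Finset.prod_mul_distrib, Finset.prod_mul_distrib, Equiv.prod_comp π y] at h1
    have h2 := mul_right_cancel₀ (Finset.prod_ne_zero_iff.mpr fun i _ => hy i) h1
    rw [h2, Finset.prod_const, Finset.card_univ, Fintype.card_fin, ← pow_mul,
      hζ.pow_eq_one_iff_dvd] at hc'
    exact hc'
  have hcard : Fintype.card {i : Fin n // y i ≠ 0} = K * ℓ := by
    have : Function.Bijective fun x : J₀ × Fin ℓ => (⟨f x, hfne x⟩ : {i : Fin n // y i ≠ 0}) :=
      ⟨fun x x' h => hf (congrArg Subtype.val h), fun i => by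
        obtain ⟨x, hx⟩ := hcover i.1 i.2
        exact ⟨x, Subtype.ext hx⟩⟩
    rw [← Fintype.card_of_bijective this]
    simp [hK]
  have hcard0 : Fintype.card {i : Fin n // y i = 0} = n - K * ℓ := by
    have := Fintype.card_subtype_compl (fun i : Fin n => y i ≠ 0)
    simp only [not_not, Fintype.card_fin, hcard] at this
    exact this
  -- Room for the missing blocks: a ℓ ≤ n leaves at least (a - K) ℓ zero coordinates of y. All of X
  -- vanishes there, so their values only have to satisfy `val_pow`; ζ^(-s) is used.
  obtain ⟨e⟩ : Nonempty (Fin (a - K) × Fin ℓ ↪ {i : Fin n // y i = 0}) := by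
    apply Function.Embedding.nonempty_of_card_le
    have h1 : a * ℓ ≤ n := hℓ ▸ numDegreesDvd_mul_le hd0 hp
    rw [hcard0, Fintype.card_prod, Fintype.card_fin, Fintype.card_fin, Nat.sub_mul]
    omega
  obtain ⟨q⟩ : Nonempty (Fin a ≃ J₀ ⊕ Fin (a - K)) := by
    rw [← Fintype.card_eq, Fintype.card_sum, Fintype.card_fin, Fintype.card_fin, ← hK]
    omega
  have he : Function.Injective fun x => (e x).1 := fun x x' h => e.injective (Subtype.ext h)
  let pt : J₀ ⊕ Fin (a - K) → Fin ℓ → Fin n :=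
    Sum.elim (fun j s => f (j, s)) (fun r s => (e (r, s)).1)
  let v : Fin n → ℂ := Function.extend (fun x => (e x).1) (fun x => (ζ ^ (x.2 : ℕ))⁻¹) 1
  have hv : ∀ x, v (e x).1 = (ζ ^ (x.2 : ℕ))⁻¹ := fun x => he.extend_apply _ _ x
  have hv0 : ∀ i, v i ≠ 0 := by
    intro i
    by_cases h : ∃ x, (e x).1 = i
    · obtain ⟨x, rfl⟩ := h
      rw [hv]
      exact inv_ne_zero (pow_ne_zero _ hζ0)
    · simp only [v]
      rw [Function.extend_apply' _ _ _ h]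
      exact one_ne_zero
  let F : BlockFrame m n ℓ ζ (Fin a) :=
    { pt := fun j => pt (q j)
      pt_injective := by
        rintro ⟨j, s⟩ ⟨j', s'⟩ h
        simp only at h
        rcases hj : q j with i | r <;> rcases hj' : q j' with i' | r' <;>
          simp only [hj, hj', pt, Sum.elim_inl, Sum.elim_inr] at h
        · have h1 := hf h
          simp only [Prod.mk.injEq] at h1
          rw [← h1.1, ← hj] at hj'
          rw [h1.2, q.injective hj']
        · exact absurd (h ▸ (e (r', s')).2) (hfne _)
        · exact absurd (h ▸ (e (r, s)).2) (hfne _)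
        · have h1 := he h
          simp only [Prod.mk.injEq] at h1
          rw [← h1.1, ← hj] at hj'
          rw [h1.2, q.injective hj']
      val := fun i => if y i ≠ 0 then y i else v i
      val_ne_zero := fun i => by
        split_ifs with h
        · exact h
        · exact hv0 i
      val_pow := fun j s => by
        rcases hj : q j with i | r
        · have h1 : pt (Sum.inl i) s = f (i, s) := rfl
          rw [h1, if_pos (hfne _)]
          exact (hpow s i.1).trans i.2.2
        · have h1 : pt (Sum.inr r) s = (e (r, s)).1 := rfl
          rw [h1, if_neg (not_not.mpr (e (r, s)).2), hv, inv_pow, ← pow_mul, ← pow_mul, mul_comm,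
            mul_comm m, inv_mul_cancel₀ (pow_ne_zero _ hζ0)] }
  refine ⟨F, fun x hx => BlockFrame.mem_space.mpr ⟨fun i hi => ?_, fun j s t => ?_⟩⟩
  · apply hy0 i _ x hx
    by_contra h
    obtain ⟨⟨j, s⟩, hjs⟩ := hcover i h
    apply hi (q.symm (Sum.inl j)) s
    change pt (q (q.symm (Sum.inl j))) s = i
    rw [Equiv.apply_symm_apply, ← hjs]
    rfl
  · change (if y (pt (q j) t) ≠ 0 then y (pt (q j) t) else v (pt (q j) t)) * x (pt (q j) s) =
      (if y (pt (q j) s) ≠ 0 then y (pt (q j) s) else v (pt (q j) s)) * x (pt (q j) t)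
    rcases hj : q j with i | r
    · have h1 : ∀ s, pt (Sum.inl i) s = (π ^ (s : ℕ)) i.1 := fun s => rfl
      have h2 : ∀ s : ℕ, y i.1 * x ((π ^ s) i.1) = y ((π ^ s) i.1) * x i.1 := by
        intro s
        induction s with
        | zero => rfl
        | succ s ih =>
          have h3 := hyc ((π ^ s) i.1)
          have h4 := (hX x).mp hx ((π ^ s) i.1)
          rw [pow_succ' π, Equiv.Perm.mul_apply]
          apply mul_left_cancel₀ hζ0
          linear_combination c ((π ^ s) i.1) * ih - y i.1 * h4 + x i.1 * h3
      rw [h1, h1, if_pos (hne _ _ i.2.1), if_pos (hne _ _ i.2.1)]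
      apply mul_left_cancel₀ i.2.1
      linear_combination y ((π ^ (t : ℕ)) i.1) * h2 s - y ((π ^ (s : ℕ)) i.1) * h2 t
    · have h1 : ∀ s, x (pt (Sum.inr r) s) = 0 := fun s => hy0 _ (e (r, s)).2 x hx
      rw [h1, h1, mul_zero, mul_zero]

/-! ### Eigenspaces of cycles and words as systems of equations -/

namespace ColoredCycle

variable {m n ℓ : ℕ}

theorem mem_supp {σ : ColoredCycle m n ℓ} {i : Fin n} : i ∈ σ.supp ↔ ∃ k, σ.pt k = i := by
  simp [supp]

theorem pt_mem_supp (σ : ColoredCycle m n ℓ) (k : Fin ℓ) : σ.pt k ∈ σ.supp :=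
  mem_supp.mpr ⟨k, rfl⟩

theorem card_supp (σ : ColoredCycle m n ℓ) : σ.supp.card = ℓ := by
  simp [supp, Finset.card_image_of_injective _ σ.pt_injective]

theorem min_supp (σ : ColoredCycle m n ℓ) (hℓ : 0 < ℓ) : σ.supp.min = σ.pt ⟨0, hℓ⟩ := by
  apply le_antisymm (Finset.min_le (σ.pt_mem_supp _))
  refine Finset.le_min fun i hi => ?_
  obtain ⟨k, rfl⟩ := mem_supp.mp hi
  rw [WithTop.coe_le_coe]
  by_cases h : (k : ℕ) = 0
  · rw [show k = ⟨0, hℓ⟩ from Fin.ext h]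
  · exact (σ.pt_first ⟨0, hℓ⟩ k rfl h).le

theorem matrix_mulVec_pt (σ : ColoredCycle m n ℓ) (x : Fin n → ℂ) (k : Fin ℓ) :
    σ.matrix.mulVec x (σ.pt (finRotate ℓ k)) = σ.col k * x (σ.pt k) := by
  rw [matrix, Matrix.add_mulVec, Matrix.sum_mulVec, Matrix.sum_mulVec, Pi.add_apply,
    Finset.sum_apply, Finset.sum_apply, Finset.sum_eq_single k, Finset.sum_eq_zero, add_zero]
  · simp [Matrix.single_mulVec]
  · intro j hj
    have : σ.pt (finRotate ℓ k) ≠ j := by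
      rintro rfl
      exact Finset.mem_compl.mp hj (σ.pt_mem_supp _)
    rw [Matrix.single_mulVec, Function.update_of_ne this, Pi.zero_apply]
  · intro j _ hj
    have : σ.pt (finRotate ℓ k) ≠ σ.pt (finRotate ℓ j) := fun h =>
      hj ((finRotate ℓ).injective (σ.pt_injective h)).symm
    rw [Matrix.single_mulVec, Function.update_of_ne this, Pi.zero_apply]
  · simp

theorem matrix_mulVec_of_notMem (σ : ColoredCycle m n ℓ) (x : Fin n → ℂ) {i : Fin n}
    (hi : i ∉ σ.supp) : σ.matrix.mulVec x i = x i := by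
  rw [matrix, Matrix.add_mulVec, Matrix.sum_mulVec, Matrix.sum_mulVec, Pi.add_apply,
    Finset.sum_apply, Finset.sum_apply, Finset.sum_eq_zero, Finset.sum_eq_single i, zero_add]
  · simp [Matrix.single_mulVec]
  · intro j _ hj
    simp [Matrix.single_mulVec, hj.symm]
  · intro h
    exact absurd (Finset.mem_compl.mpr hi) h
  · intro j _
    have : i ≠ σ.pt (finRotate ℓ j) := by
      rintro rfl
      exact hi (σ.pt_mem_supp _)
    rw [Matrix.single_mulVec, Function.update_of_ne this, Pi.zero_apply]

theorem mem_eigen {σ : ColoredCycle m n ℓ} {ζ : ℂ} (hζ : ζ ≠ 1) {x : Fin n → ℂ} :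
    x ∈ σ.eigen ζ ↔ (∀ i, i ∉ σ.supp → x i = 0) ∧
      ∀ k, σ.col k * x (σ.pt k) = ζ * x (σ.pt (finRotate ℓ k)) := by
  rw [eigen, matEigenspace, Module.End.mem_eigenspace_iff, Matrix.toLin'_apply]
  constructor
  · intro h
    refine ⟨fun i hi => ?_, fun k => ?_⟩
    · have h1 := congrFun h i
      rw [σ.matrix_mulVec_of_notMem x hi, Pi.smul_apply, smul_eq_mul] at h1
      have h2 : (ζ - 1) * x i = 0 := by linear_combination -h1
      exact (mul_eq_zero.mp h2).resolve_left (sub_ne_zero.mpr hζ)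
    · rw [← σ.matrix_mulVec_pt, h]; rfl
  · rintro ⟨h1, h2⟩
    ext i
    by_cases hi : i ∈ σ.supp
    · obtain ⟨k, rfl⟩ := mem_supp.mp hi
      obtain ⟨k, rfl⟩ := (finRotate ℓ).surjective k
      rw [σ.matrix_mulVec_pt, h2]; rfl
    · rw [σ.matrix_mulVec_of_notMem x hi, Pi.smul_apply, h1 i hi, smul_zero]

end ColoredCycle

namespace EigenWord

variable {m n ℓ a : ℕ} {ζ : ℂ}

theorem eq_of_pt_eq {w : EigenWord m n ℓ a}
    (hw : ∀ i j, i ≠ j → Disjoint (w.cycles i).supp (w.cycles j).supp) {q q' : Fin a}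
    {k k' : Fin ℓ} (h : (w.cycles q).pt k = (w.cycles q').pt k') : q = q' ∧ k = k' := by
  have h1 : q = q' := by
    by_contra hq
    exact Finset.disjoint_left.mp (hw q q' hq) ((w.cycles q).pt_mem_supp k)
      (h ▸ (w.cycles q').pt_mem_supp k')
  subst h1
  exact ⟨rfl, (w.cycles q).pt_injective h⟩

/-- The sum of the eigenspaces of the cycles of a word, described by equations. -/
def space (ζ : ℂ) (w : EigenWord m n ℓ a) : Submodule ℂ (Fin n → ℂ) where
  carrier := {x | (∀ i, (∀ q, i ∉ (w.cycles q).supp) → x i = 0) ∧ ∀ q k,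
    (w.cycles q).col k * x ((w.cycles q).pt k) = ζ * x ((w.cycles q).pt (finRotate ℓ k))}
  add_mem' {x y} hx hy := ⟨fun i hi => by simp [hx.1 i hi, hy.1 i hi], fun q k => by
    simp only [Pi.add_apply]; linear_combination hx.2 q k + hy.2 q k⟩
  zero_mem' := by simp
  smul_mem' r x hx := ⟨fun i hi => by simp [hx.1 i hi], fun q k => by
    simp only [Pi.smul_apply, smul_eq_mul]; linear_combination r * hx.2 q k⟩

theorem mem_space {w : EigenWord m n ℓ a} {x : Fin n → ℂ} : x ∈ w.space ζ ↔
    (∀ i, (∀ q, i ∉ (w.cycles q).supp) → x i = 0) ∧ ∀ q k,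
    (w.cycles q).col k * x ((w.cycles q).pt k) = ζ * x ((w.cycles q).pt (finRotate ℓ k)) :=
  Iff.rfl

/-- The restriction of a vector in the space of a word to the support of one of the cycles. -/
theorem restrict_mem_eigen (hζ : ζ ≠ 1) {w : EigenWord m n ℓ a} {x : Fin n → ℂ}
    (hx : x ∈ w.space ζ) (q : Fin a) :
    (fun i => if i ∈ (w.cycles q).supp then x i else 0) ∈ (w.cycles q).eigen ζ := by
  rw [ColoredCycle.mem_eigen hζ]
  refine ⟨fun i hi => by simp [hi], fun k => ?_⟩
  simp only [ColoredCycle.pt_mem_supp, if_true]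
  exact hx.2 q k

theorem iSup_eigen (hζ : ζ ≠ 1) {w : EigenWord m n ℓ a}
    (hw : ∀ i j, i ≠ j → Disjoint (w.cycles i).supp (w.cycles j).supp) :
    ⨆ q, (w.cycles q).eigen ζ = w.space ζ := by
  apply le_antisymm
  · refine iSup_le fun q x hx => ?_
    rw [ColoredCycle.mem_eigen hζ] at hx
    refine ⟨fun i hi => hx.1 i (hi q), fun q' k => ?_⟩
    by_cases h : q' = q
    · subst h; exact hx.2 k
    · have h1 : ∀ k, (w.cycles q').pt k ∉ (w.cycles q).supp := fun k hk =>
        Finset.disjoint_left.mp (hw q' q h) ((w.cycles q').pt_mem_supp k) hk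
      rw [hx.1 _ (h1 _), hx.1 _ (h1 _), mul_zero, mul_zero]
  · intro x hx
    have : x = ∑ q, fun i => if i ∈ (w.cycles q).supp then x i else 0 := by
      ext i
      rw [Finset.sum_apply]
      by_cases h : ∃ q, i ∈ (w.cycles q).supp
      · obtain ⟨q, hq⟩ := h
        rw [Finset.sum_eq_single q, if_pos hq]
        · intro q' _ hq'
          rw [if_neg fun h => Finset.disjoint_left.mp (hw q' q hq') h hq]
        · simp
      · push Not at h
        simp [h, hx.1 i h]
    rw [this]
    exact Submodule.sum_mem _ fun q _ =>
      Submodule.mem_iSup_of_mem q (restrict_mem_eigen hζ hx q)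

theorem iSupIndep_eigen (hζ : ζ ≠ 1) {w : EigenWord m n ℓ a}
    (hw : ∀ i j, i ≠ j → Disjoint (w.cycles i).supp (w.cycles j).supp) :
    iSupIndep fun q => (w.cycles q).eigen ζ := by
  intro q
  rw [Submodule.disjoint_def]
  intro x hx hx'
  let V : Submodule ℂ (Fin n → ℂ) := ⨅ i ∈ (w.cycles q).supp, LinearMap.ker (LinearMap.proj i)
  have hV : ⨆ j, ⨆ (_ : j ≠ q), (w.cycles j).eigen ζ ≤ V := by
    refine iSup₂_le fun j hj y hy => ?_
    simp only [V, Submodule.mem_iInf, LinearMap.mem_ker, LinearMap.proj_apply]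
    intro i hi
    exact ((ColoredCycle.mem_eigen hζ).mp hy).1 i
      fun h => Finset.disjoint_left.mp (hw j q hj) h hi
  have hxV := hV hx'
  simp only [V, Submodule.mem_iInf, LinearMap.mem_ker, LinearMap.proj_apply] at hxV
  ext i
  by_cases hi : i ∈ (w.cycles q).supp
  · exact hxV i hi
  · exact ((ColoredCycle.mem_eigen hζ).mp hx).1 i hi

theorem IsWordOf.eq_space (hζ : ζ ≠ 1) {w : EigenWord m n ℓ a} {E : Submodule ℂ (Fin n → ℂ)}
    (h : w.IsWordOf ζ E) : E = w.space ζ :=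
  h.sum_eq.trans (iSup_eigen hζ h.disjoint)

theorem IsWordOf.notMem_supp_iff {w : EigenWord m n ℓ a} {E : Submodule ℂ (Fin n → ℂ)}
    (h : w.IsWordOf ζ E) {i : Fin n} : (∀ q, i ∉ (w.cycles q).supp) ↔ i ∈ Set.range w.fixed := by
  rw [h.range_fixed]; rfl

end EigenWord

/-- Start each block at its smallest element, using addition modulo ℓ for the rotation, and sort the
blocks by these minima. The colors are the quotients of consecutive entries times ζ. -/
theorem BlockFrame.exists_word {m n ℓ a : ℕ} {ζ : ℂ} (hℓ : 0 < ℓ) (hζ0 : ζ ≠ 0) (hζ1 : ζ ≠ 1)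
    (hζ : (ζ ^ m) ^ ℓ = 1) (F : BlockFrame m n ℓ ζ (Fin a)) :
    ∃ w : EigenWord m n ℓ a, w.IsWordOf ζ F.space := by
  classical
  have : NeZero ℓ := ⟨hℓ.ne'⟩
  have hinj : ∀ {j j' s s'}, F.pt j s = F.pt j' s' → j = j' ∧ s = s' := by
    intro j j' s s' h
    have := F.pt_injective (a₁ := (j, s)) (a₂ := (j', s')) h
    simpa using this
  have hmin : ∀ j, ∃ s, ∀ t, F.pt j s ≤ F.pt j t := fun j => by
    obtain ⟨s, -, hs⟩ := Finset.exists_min_image Finset.univ (F.pt j) ⟨0, Finset.mem_univ _⟩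
    exact ⟨s, fun t => hs t (Finset.mem_univ t)⟩
  choose s₀ hs₀ using hmin
  have hmninj : Function.Injective fun j => F.pt j (s₀ j) := fun j j' h => (hinj h).1
  let T : Finset (Fin n) := Finset.univ.image fun j => F.pt j (s₀ j)
  have hT : T.card = a := by simp [T, Finset.card_image_of_injective _ hmninj]
  have hjq : ∀ q, ∃ j, F.pt j (s₀ j) = T.orderEmbOfFin hT q := fun q => by
    obtain ⟨j, -, hj⟩ := Finset.mem_image.mp (Finset.orderEmbOfFin_mem T hT q)
    exact ⟨j, hj⟩
  choose jq hjq using hjq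
  have hjinj : Function.Injective jq := fun q q' h => by
    apply (T.orderEmbOfFin hT).injective
    rw [← hjq, ← hjq, h]
  have hjsurj : Function.Surjective jq := Finite.surjective_of_injective hjinj
  let cyc : Fin a → ColoredCycle m n ℓ := fun q =>
    { pt := fun k => F.pt (jq q) (s₀ (jq q) + k)
      col := fun k => ζ * F.val (F.pt (jq q) (finRotate ℓ (s₀ (jq q) + k))) /
        F.val (F.pt (jq q) (s₀ (jq q) + k))
      pt_injective := fun k k' h => add_left_cancel (hinj h).2
      col_pow := fun k => F.val_mul_pow hζ _ _
      pt_first := fun i j hi hj => by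
        have hi0 : i = 0 := Fin.ext hi
        subst hi0
        rw [add_zero]
        refine lt_of_le_of_ne (hs₀ _ _) fun h => hj ?_
        have := (hinj h).2
        rw [left_eq_add] at this
        rw [this]; rfl }
  have hrot : ∀ q k, (cyc q).pt (finRotate ℓ k) =
      F.pt (jq q) (finRotate ℓ (s₀ (jq q) + k)) := fun q k => by
    simp only [cyc, finRotate_apply, add_assoc]
  have hsupp : ∀ i q, i ∈ (cyc q).supp ↔ ∃ s, F.pt (jq q) s = i := fun i q => by
    rw [ColoredCycle.mem_supp]
    constructor
    · rintro ⟨k, rfl⟩; exact ⟨_, rfl⟩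
    · rintro ⟨s, rfl⟩
      exact ⟨s - s₀ (jq q), by simp [cyc]⟩
  have hdisj : ∀ i j, i ≠ j → Disjoint (cyc i).supp (cyc j).supp := fun i j hij => by
    rw [Finset.disjoint_left]
    intro x hx hx'
    obtain ⟨s, hs⟩ := (hsupp x i).mp hx
    obtain ⟨t, ht⟩ := (hsupp x j).mp hx'
    exact hij (hjinj (hinj (hs.trans ht.symm)).1)
  let S : Finset (Fin n) := Finset.univ.biUnion fun q => (cyc q).supp
  have hS : Sᶜ.card = n - a * ℓ := by
    rw [Finset.card_compl, Finset.card_biUnion fun i _ j _ hij => hdisj i j hij]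
    simp [ColoredCycle.card_supp]
  let w : EigenWord m n ℓ a := ⟨Sᶜ.orderEmbOfFin hS, cyc⟩
  refine ⟨w, hdisj, EigenWord.iSupIndep_eigen hζ1 hdisj, ?_, ?_, (Sᶜ.orderEmbOfFin hS).strictMono,
    fun i j hij => ?_⟩
  · rw [EigenWord.iSup_eigen hζ1 hdisj]
    ext x
    rw [BlockFrame.mem_space, EigenWord.mem_space]
    refine and_congr (forall_congr' fun i => imp_congr_left ?_) ?_
    · simp only [w, hsupp, not_exists]
      exact ⟨fun h q s => h _ s, fun h j s => by
        obtain ⟨q, rfl⟩ := hjsurj j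
        exact h q s⟩
    · have hcol : ∀ q k, (cyc q).col k * x ((cyc q).pt k) = ζ * x ((cyc q).pt (finRotate ℓ k)) ↔
          F.val (F.pt (jq q) (finRotate ℓ (s₀ (jq q) + k))) * x (F.pt (jq q) (s₀ (jq q) + k)) =
          F.val (F.pt (jq q) (s₀ (jq q) + k)) *
            x (F.pt (jq q) (finRotate ℓ (s₀ (jq q) + k))) := by
        intro q k
        rw [hrot]
        simp only [cyc]
        rw [div_mul_eq_mul_div, div_eq_iff (F.val_ne_zero _)]
        constructor
        · intro h
          apply mul_left_cancel₀ hζ0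
          linear_combination h
        · intro h
          linear_combination ζ * h
      simp only [w, hcol]
      constructor
      · intro h q k
        exact h _ _ _
      · intro h j
        obtain ⟨q, rfl⟩ := hjsurj j
        have hstep : ∀ s, F.val (F.pt (jq q) (finRotate ℓ s)) * x (F.pt (jq q) s) =
            F.val (F.pt (jq q) s) * x (F.pt (jq q) (finRotate ℓ s)) := by
          intro s
          have := h q (s - s₀ (jq q))
          rwa [add_sub_cancel] at this
        exact F.forall_of_step _ _ hstep
  · rw [Finset.range_orderEmbOfFin]
    ext i
    simp [S, w]
  · change (cyc i).supp.min < (cyc j).supp.min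
    rw [ColoredCycle.min_supp _ hℓ, ColoredCycle.min_supp _ hℓ, WithTop.coe_lt_coe]
    have h0 : ∀ q, (cyc q).pt ⟨0, hℓ⟩ = T.orderEmbOfFin hT q := fun q => by
      rw [← hjq]
      change F.pt _ (_ + 0) = _
      rw [add_zero]
    rw [h0, h0]
    exact (T.orderEmbOfFin hT).strictMono hij

/-! ### The poset of eigenspaces: dimensions, covers, semimodularity -/

/-- The standing assumptions on the group `G(m,p,n)` and the root of unity `ζ`. -/
structure EigenSetup (m p d : ℕ) (ζ : ℂ) : Prop where
  pos : 0 < m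
  dvd : p ∣ m
  one_lt : 1 < d
  prim : IsPrimitiveRoot ζ d

namespace EigenSetup

variable {m p d : ℕ} {ζ : ℂ}

theorem d_pos (h : EigenSetup m p d ζ) : 0 < d := by have := h.one_lt; omega

theorem ne_zero (h : EigenSetup m p d ζ) : ζ ≠ 0 := h.prim.ne_zero h.d_pos.ne'

theorem ne_one (h : EigenSetup m p d ζ) : ζ ≠ 1 := h.prim.ne_one h.one_lt

theorem pow_prim (h : EigenSetup m p d ζ) : IsPrimitiveRoot (ζ ^ m) (cycleLength m d) :=
  isPrimitiveRoot_pow_cycleLength h.d_pos h.prim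

theorem cycleLength_pos (h : EigenSetup m p d ζ) : 0 < cycleLength m d :=
  _root_.cycleLength_pos h.d_pos

end EigenSetup

theorem finrank_inf_ker {V : Type*} [AddCommGroup V] [Module ℂ V] [FiniteDimensional ℂ V]
    {X : Submodule ℂ V} {φ : V →ₗ[ℂ] ℂ} (h : ∃ x ∈ X, φ x ≠ 0) :
    Module.finrank ℂ ↥(X ⊓ LinearMap.ker φ) + 1 = Module.finrank ℂ X := by
  obtain ⟨x, hx, hφ⟩ := h
  have h0 : φ.comp X.subtype ≠ 0 := fun h0 => hφ (LinearMap.congr_fun h0 ⟨x, hx⟩)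
  rw [← Module.Dual.finrank_ker_add_one_of_ne_zero (f := φ.comp X.subtype) h0,
    LinearMap.ker_comp, ← Submodule.map_comap_subtype, Submodule.finrank_map_subtype_eq]

/-- The kernel of `φ` is a reflecting hyperplane, as far as eigenspaces are concerned. -/
def IsReflecting (m p : ℕ) {n : ℕ} (ζ : ℂ) (φ : (Fin n → ℂ) →ₗ[ℂ] ℂ) : Prop :=
  ∀ X, IsMonomialEigenspace m p ζ X → IsMonomialEigenspace m p ζ (X ⊓ LinearMap.ker φ)

theorem isReflecting_diff {m p d n : ℕ} {ζ : ℂ} (h : EigenSetup m p d ζ) {i j : Fin n}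
    (hij : i ≠ j) {κ : ℂ} (hκ : κ ^ m = 1) : IsReflecting m p ζ (diffFunctional i j κ) := by
  intro X hX
  by_cases hx : ∃ x ∈ X, x i ≠ κ * x j
  · obtain ⟨x, hx, hne⟩ := hx
    exact hX.inf_ker_diff h.pos h.d_pos h.prim.pow_eq_one hij hκ hx hne
  · push Not at hx
    rwa [inf_eq_left.mpr fun x hx' => by simp [hx x hx']]

theorem isReflecting_proj {m p d n : ℕ} {ζ : ℂ} (h : EigenSetup m p d ζ) (hpm : m ≠ p)
    (i : Fin n) : IsReflecting m p ζ (LinearMap.proj i : (Fin n → ℂ) →ₗ[ℂ] ℂ) := by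
  intro X hX
  by_cases hx : ∃ x ∈ X, x i ≠ 0
  · obtain ⟨x, hx, hne⟩ := hx
    exact hX.inf_ker_proj h.pos h.d_pos h.dvd hpm h.prim.pow_eq_one hx hne
  · push Not at hx
    rwa [inf_eq_left.mpr fun x hx' => by simp [hx x hx']]

namespace EigenspacePoset

variable {m p d n : ℕ} {ζ : ℂ}

theorem le_iff {E F : EigenspacePoset (monomialGroup m p n) ζ} : E ≤ F ↔ F.space ≤ E.space :=
  Iff.rfl

theorem lt_iff {E F : EigenspacePoset (monomialGroup m p n) ζ} : E < F ↔ F.space < E.space :=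
  Iff.rfl

theorem space_injective {E F : EigenspacePoset (monomialGroup m p n) ζ}
    (h : E.space = F.space) : E = F :=
  le_antisymm (le_iff.mpr h.ge) (le_iff.mpr h.le)

theorem isMonomialEigenspace (h : EigenSetup m p d ζ)
    (E : EigenspacePoset (monomialGroup m p n) ζ) : IsMonomialEigenspace m p ζ E.space :=
  (mem_eigenspaces_iff h.pos ζ _).mp (OrderDual.ofDual E).2

/-- The element of the poset with a given underlying subspace. -/
def ofSpace (h : EigenSetup m p d ζ) {X : Submodule ℂ (Fin n → ℂ)}
    (hX : IsMonomialEigenspace m p ζ X) : EigenspacePoset (monomialGroup m p n) ζ :=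
  OrderDual.toDual ⟨X, (mem_eigenspaces_iff h.pos ζ _).mpr hX⟩

theorem exists_frame_le (h : EigenSetup m p d ζ) (E : EigenspacePoset (monomialGroup m p n) ζ) :
    ∃ (F : BlockFrame m n (cycleLength m d) ζ (Fin (numDegreesDvd m p n d)))
      (E' : EigenspacePoset (monomialGroup m p n) ζ), E'.space = F.space ∧ E' ≤ E := by
  obtain ⟨F, hF⟩ := (E.isMonomialEigenspace h).exists_le_space h.pos h.dvd h.one_lt h.prim rfl
  exact ⟨F, ofSpace h (F.isMonomialEigenspace h.one_lt h.dvd h.prim rfl (Fintype.card_fin _)),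
    rfl, hF⟩

theorem exists_frame (h : EigenSetup m p d ζ) {E : EigenspacePoset (monomialGroup m p n) ζ}
    (hE : IsMin E) :
    ∃ F : BlockFrame m n (cycleLength m d) ζ (Fin (numDegreesDvd m p n d)), E.space = F.space := by
  obtain ⟨F, E', hE', hle⟩ := E.exists_frame_le h
  rw [← hE.eq_of_le hle]
  exact ⟨F, hE'⟩

theorem finrank_of_isMin (h : EigenSetup m p d ζ) {E : EigenspacePoset (monomialGroup m p n) ζ}
    (hE : IsMin E) : Module.finrank ℂ E.space = numDegreesDvd m p n d := by
  obtain ⟨F, hF⟩ := exists_frame h hE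
  rw [hF, F.finrank_space h.cycleLength_pos, Fintype.card_fin]

theorem finrank_lt {E F : EigenspacePoset (monomialGroup m p n) ζ} (h : E < F) :
    Module.finrank ℂ F.space < Module.finrank ℂ E.space :=
  Submodule.finrank_lt_finrank_of_lt (lt_iff.mp h)

/-- Every eigenspace is contained in a frame space, which has dimension a(d), so an eigenspace of
this dimension cannot be enlarged. Maximality can thus be read off the dimension, which monomial
maps preserve. -/
theorem isMin_of_finrank (h : EigenSetup m p d ζ) {E : EigenspacePoset (monomialGroup m p n) ζ}
    (hE : Module.finrank ℂ E.space = numDegreesDvd m p n d) : IsMin E := by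
  obtain ⟨F, E', hE', hle⟩ := E.exists_frame_le h
  have h1 : E' = E := by
    by_contra hne
    have := finrank_lt (lt_of_le_of_ne hle hne)
    rw [hE', F.finrank_space h.cycleLength_pos, Fintype.card_fin] at this
    omega
  intro E'' hE''
  by_contra hne
  obtain ⟨F₂, E₂, hE₂, hle₂⟩ := E''.exists_frame_le h
  have := finrank_lt (lt_of_le_of_lt hle₂ (lt_of_le_not_ge hE'' hne))
  rw [hE₂, F₂.finrank_space h.cycleLength_pos, Fintype.card_fin] at this
  omega

theorem finrank_le (h : EigenSetup m p d ζ) (E : EigenspacePoset (monomialGroup m p n) ζ) :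
    Module.finrank ℂ E.space ≤ numDegreesDvd m p n d := by
  obtain ⟨F, E', hE', hle⟩ := E.exists_frame_le h
  calc Module.finrank ℂ E.space ≤ Module.finrank ℂ E'.space := Submodule.finrank_mono hle
    _ = _ := by rw [hE', F.finrank_space h.cycleLength_pos, Fintype.card_fin]

/-- If `E < E'`, then some reflecting hyperplane contains `E'` but not `E`. -/
theorem exists_isReflecting (h : EigenSetup m p d ζ)
    {E E' : EigenspacePoset (monomialGroup m p n) ζ} (hlt : E < E') :
    ∃ φ, IsReflecting m p ζ φ ∧ (∃ x ∈ E.space, φ x ≠ 0) ∧ E'.space ≤ LinearMap.ker φ := by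
  rcases (E.isMonomialEigenspace h).exists_hyperplane h.pos h.d_pos h.dvd h.prim.pow_eq_one
    (E'.isMonomialEigenspace h) (lt_iff.mp hlt) with
    ⟨i, j, κ, hij, hκ, hY, x, hx, hne⟩ | ⟨hpm, i, hY, x, hx, hne⟩
  · exact ⟨diffFunctional i j κ, isReflecting_diff h hij hκ, ⟨x, hx, by simpa [sub_eq_zero] using hne⟩,
      fun y hy => by simp [hY y hy]⟩
  · exact ⟨LinearMap.proj i, isReflecting_proj h hpm i, ⟨x, hx, hne⟩, fun y hy => by simp [hY y hy]⟩

/-- The intersection of an eigenspace with a reflecting hyperplane. -/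
def inter (h : EigenSetup m p d ζ) (E : EigenspacePoset (monomialGroup m p n) ζ)
    {φ : (Fin n → ℂ) →ₗ[ℂ] ℂ} (hφ : IsReflecting m p ζ φ) :
    EigenspacePoset (monomialGroup m p n) ζ :=
  ofSpace h (hφ _ (E.isMonomialEigenspace h))

theorem covBy_of_finrank {E F : EigenspacePoset (monomialGroup m p n) ζ} (hle : E ≤ F)
    (hd : Module.finrank ℂ F.space + 1 = Module.finrank ℂ E.space) : E ⋖ F := by
  refine ⟨lt_of_le_of_ne hle (by rintro rfl; omega), fun G h1 h2 => ?_⟩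
  have := finrank_lt h1
  have := finrank_lt h2
  omega

theorem covBy_inter (h : EigenSetup m p d ζ) {E : EigenspacePoset (monomialGroup m p n) ζ}
    {φ : (Fin n → ℂ) →ₗ[ℂ] ℂ} (hφ : IsReflecting m p ζ φ) (hE : ∃ x ∈ E.space, φ x ≠ 0) :
    E ⋖ inter h E hφ :=
  covBy_of_finrank (le_iff.mpr inf_le_left) (finrank_inf_ker hE)

/-- A reflecting hyperplane separating E from F cuts E in an eigenspace that is strictly above E and
at most F in the poset; the cover leaves no room between. -/
theorem eq_inter_of_covBy (h : EigenSetup m p d ζ)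
    {E F : EigenspacePoset (monomialGroup m p n) ζ} (hEF : E ⋖ F) :
    ∃ (φ : (Fin n → ℂ) →ₗ[ℂ] ℂ) (hφ : IsReflecting m p ζ φ),
      (∃ x ∈ E.space, φ x ≠ 0) ∧ F = inter h E hφ := by
  obtain ⟨φ, hφ, hE, hle⟩ := exists_isReflecting h hEF.1
  refine ⟨φ, hφ, hE, ?_⟩
  have h1 : inter h E hφ ≤ F := le_iff.mpr (le_inf (le_iff.mp hEF.1.le) hle)
  exact (hEF.eq_or_eq (covBy_inter h hφ hE).1.le h1).resolve_left
    (covBy_inter h hφ hE).1.ne' |>.symm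

theorem finrank_of_covBy (h : EigenSetup m p d ζ)
    {E F : EigenspacePoset (monomialGroup m p n) ζ} (hEF : E ⋖ F) :
    Module.finrank ℂ F.space + 1 = Module.finrank ℂ E.space := by
  obtain ⟨φ, hφ, hE, rfl⟩ := eq_inter_of_covBy h hEF
  exact finrank_inf_ker hE

/-- Upper intervals of the poset of eigenspaces are upper semimodular. -/
theorem exists_covBy_of_covBy (h : EigenSetup m p d ζ)
    {E A B : EigenspacePoset (monomialGroup m p n) ζ} (hA : E ⋖ A) (hB : E ⋖ B) (hAB : A ≠ B) :
    ∃ C, A ⋖ C ∧ B < C ∧ ∀ Y, A ≤ Y → B ≤ Y → C ≤ Y := by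
  obtain ⟨φ, hφ, hE, rfl⟩ := eq_inter_of_covBy h hB
  -- If the hyperplane of B contained A, then A would lie inside B, and two covers of E that are
  -- comparable coincide.
  have hAφ : ∃ x ∈ A.space, φ x ≠ 0 := by
    by_contra hcon
    push Not at hcon
    have h1 : inter h E hφ ≤ A := le_iff.mpr (le_inf (le_iff.mp hA.1.le) fun x hx => hcon x hx)
    exact hAB ((hA.eq_or_eq hB.1.le h1).resolve_left hB.1.ne').symm
  have hC := covBy_inter h hφ hAφ
  refine ⟨inter h A hφ, hC, lt_of_le_of_ne ?_ ?_, fun Y hAY hBY => ?_⟩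
  · exact le_iff.mpr (inf_le_inf_right _ (le_iff.mp hA.1.le))
  · intro heq
    have h1 := finrank_of_covBy h hA
    have h2 := finrank_of_covBy h hB
    have h3 := finrank_of_covBy h hC
    rw [← heq] at h3
    omega
  · exact le_iff.mpr (le_inf (le_iff.mp hAY) ((le_iff.mp hBY).trans inf_le_right))

theorem isMonomialEigenspace_bot (h : EigenSetup m p d ζ) :
    IsMonomialEigenspace m p ζ (⊥ : Submodule ℂ (Fin n → ℂ)) := by
  refine ⟨1, fun _ => 1, by simp, by simp, fun x => ?_⟩
  rw [Submodule.mem_bot]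
  constructor
  · rintro rfl; simp
  · intro hx
    ext j
    have h1 := hx j
    rw [Equiv.Perm.one_apply] at h1
    have h2 : (1 - ζ) * x j = 0 := by linear_combination h1
    exact (mul_eq_zero.mp h2).resolve_left (sub_ne_zero.mpr h.ne_one.symm)

theorem isMax_iff (h : EigenSetup m p d ζ) {E : EigenspacePoset (monomialGroup m p n) ζ} :
    IsMax E ↔ Module.finrank ℂ E.space = 0 := by
  rw [Submodule.finrank_eq_zero]
  constructor
  · intro hE
    have h1 : E ≤ ofSpace h (isMonomialEigenspace_bot h) := le_iff.mpr bot_le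
    rw [hE.eq_of_le h1]
    rfl
  · intro hE F hF
    rw [le_iff, hE]
    exact bot_le

theorem finite (h : EigenSetup m p d ζ) : Finite (EigenspacePoset (monomialGroup m p n) ζ) := by
  have h1 : (Set.univ.pi fun _ : Fin n => {c : ℂ | c ^ m = 1}).Finite := by
    refine Set.Finite.pi (t := fun _ : Fin n => {c : ℂ | c ^ m = 1}) fun _ => ?_
    refine ((Polynomial.nthRoots m (1 : ℂ)).toFinset.finite_toSet).subset fun c hc => ?_
    simpa [Polynomial.mem_nthRoots h.pos] using hc
  have h2 : (eigenspaces (monomialGroup m p n) ζ).Finite := by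
    refine (Set.Finite.image2 (fun (π : Equiv.Perm (Fin n)) c =>
      matEigenspace (monomialMatrix π c) ζ) Set.finite_univ h1).subset ?_
    rintro X ⟨g, ⟨π, c, hc, -, hg⟩, rfl⟩
    exact ⟨π, Set.mem_univ _, c, fun i _ => hc i, by rw [hg]⟩
  have := h2.to_subtype
  exact inferInstanceAs (Finite (↥(eigenspaces (monomialGroup m p n) ζ)))

end EigenspacePoset

/-! ### Recursive atom orderings and semimodularity -/

/-- In `filter p l ++ filter (¬ p) l`, the elements with `p` come first. -/
theorem lt_of_filter_append {α : Type*} (l : List α) (p : α → Bool)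
    {s t : Fin (l.filter p ++ l.filter fun b => !p b).length}
    (hs : p ((l.filter p ++ l.filter fun b => !p b).get s) = true)
    (ht : ¬ p ((l.filter p ++ l.filter fun b => !p b).get t) = true) : s < t := by
  simp only [List.get_eq_getElem] at hs ht
  by_contra hle
  rw [not_lt, Fin.le_def] at hle
  by_cases h : (s : ℕ) < (l.filter p).length
  · rw [List.getElem_append_left (by omega)] at ht
    exact ht (List.mem_filter.mp (List.getElem_mem _)).2
  · rw [List.getElem_append_right (by omega)] at hs
    have hlt : (s : ℕ) - (l.filter p).length < (l.filter fun b => !p b).length := by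
      have := s.2
      simp only [List.length_append] at this
      omega
    have h2 := (List.mem_filter.mp (List.getElem_mem hlt)).2
    rw [hs] at h2
    exact absurd h2 (by simp)

section RecursiveAtomOrdering

variable {P : Type} [PartialOrder P] [OrderTop P]

/-- If every ordering of the atoms is recursive in each interval `[a_j, ⊤]`, then only the exchange
property has to be checked. -/
theorem isRAOFrom_of_exchange [Finite P] {x : P} {l : List P} (ne_top : x ≠ ⊤)
    (not_covBy : ¬ x ⋖ ⊤) (nodup : l.Nodup) (mem_iff : ∀ a, a ∈ l ↔ x ⋖ a)
    (sub : ∀ a ∈ l, ∀ l' : List P, l'.Nodup → (∀ b, b ∈ l' ↔ a ⋖ b) → IsRAOFrom a l')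
    (exchange : ∀ i j : Fin l.length, i < j → ∀ y : P, l.get i < y → l.get j < y →
      ∃ k < j, ∃ z : P, l.get j ⋖ z ∧ l.get k < z ∧ z ≤ y) : IsRAOFrom x l := by
  classical
  have := Fintype.ofFinite P
  let A : P → List P := fun a => (Finset.univ.filter (a ⋖ ·)).toList
  have hA : ∀ a, (A a).Nodup := fun a => Finset.nodup_toList _
  have hAmem : ∀ a b, b ∈ A a ↔ a ⋖ b := fun a b => by simp [A]
  -- As any ordering of the atoms of [a_j, ⊤] is recursive, the one that lists the atoms above
  -- earlier a_i first may be chosen.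
  let p : Fin l.length → P → Bool := fun j b => decide (∃ i < j, l.get i ≤ b)
  refine IsRAOFrom.rank_gt_one ne_top not_covBy nodup mem_iff
    (fun j => (A (l.get j)).filter (p j) ++ (A (l.get j)).filter (fun b => !p j b))
    (fun j => sub _ (l.get_mem j) _ ?_ fun b => ?_) (fun j s t hs ht => ?_) exchange
  · exact (List.filter_append_perm _ _).nodup_iff.mpr (hA _)
  · rw [(List.filter_append_perm _ _).mem_iff, hAmem]
  · have hp : ∀ b, p j b = true ↔ ∃ i < j, l.get i ≤ b := fun b => by simp [p]
    rw [← hp] at hs ht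
    exact lt_of_filter_append _ _ hs ht

/-- In a semimodular upper set of a finite poset, every ordering of the atoms is recursive. -/
theorem isRAOFrom_of_semimodular [Finite P] (D : Set P) (hD : IsUpperSet D)
    (hsm : ∀ x ∈ D, ∀ a b, x ⋖ a → x ⋖ b → a ≠ b → ∀ y, a < y → b < y →
      ∃ z, a ⋖ z ∧ b < z ∧ z ≤ y) :
    ∀ x ∈ D, x ≠ ⊤ → ∀ l : List P, l.Nodup → (∀ a, a ∈ l ↔ x ⋖ a) → IsRAOFrom x l := by
  intro x
  induction x using WellFoundedGT.induction with
  | ind x ih =>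
    intro hx hne l hnd hmem
    by_cases hc : x ⋖ ⊤
    · have h1 : ∀ a, x ⋖ a ↔ a = ⊤ := fun a => ⟨fun ha => by
        by_contra hat
        exact hc.2 ha.1 (lt_top_iff_ne_top.mpr hat), fun ha => ha ▸ hc⟩
      have h2 : l = [⊤] := by
        apply List.perm_singleton.mp
        rw [List.perm_ext_iff_of_nodup hnd (List.nodup_singleton _)]
        intro a
        rw [hmem, h1, List.mem_singleton]
      rw [h2]
      exact IsRAOFrom.rank_one hc
    -- The exchange condition holds with k = i itself, by semimodularity.
    · refine isRAOFrom_of_exchange hne hc hnd hmem (fun a ha l' hl' hmem' => ?_)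
        fun i j hij y hi hj => ⟨i, hij, ?_⟩
      · have hxa := (hmem a).mp ha
        refine ih a hxa.1 (hD hxa.1.le hx) ?_ l' hl' hmem'
        rintro rfl
        exact hc hxa
      · have hij' : l.get j ≠ l.get i := fun h => hij.ne' (hnd.get_inj_iff.mp h)
        exact hsm x hx _ _ ((hmem _).mp (l.get_mem j)) ((hmem _).mp (l.get_mem i)) hij' y hj hi

end RecursiveAtomOrdering

/-! ### The adjoined bottom and top elements -/

section Hat

theorem hat_cases {P : Type} (x : HatPoset P) : x = ⊥ ∨ x = ⊤ ∨ ∃ y : P, x = toHat y := by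
  induction x using WithBot.recBotCoe with
  | bot => exact Or.inl rfl
  | coe x =>
    induction x using WithTop.recTopCoe with
    | top => exact Or.inr (Or.inl rfl)
    | coe x => exact Or.inr (Or.inr ⟨x, rfl⟩)

theorem toHat_injective {P : Type} : Function.Injective (toHat : P → HatPoset P) := fun x y h => by
  simpa [toHat] using h

variable {P : Type} [PartialOrder P]

theorem toHat_le_toHat {x y : P} : toHat x ≤ toHat y ↔ x ≤ y := by
  simp [toHat]

theorem toHat_lt_toHat {x y : P} : toHat x < toHat y ↔ x < y := by
  simp [toHat]

theorem toHat_covBy_toHat {x y : P} : toHat x ⋖ toHat y ↔ x ⋖ y := by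
  simp [toHat]

theorem toHat_covBy_top {x : P} : toHat x ⋖ ⊤ ↔ IsMax x := by
  rw [toHat, show (⊤ : HatPoset P) = ((⊤ : WithTop P) : WithBot (WithTop P)) from rfl,
    WithBot.coe_covBy_coe, WithTop.coe_covBy_top]

theorem bot_covBy_toHat {x : P} : ⊥ ⋖ toHat x ↔ IsMin x := by
  rw [toHat, WithBot.bot_covBy_coe]
  constructor
  · intro h y hy
    exact WithTop.coe_le_coe.mp (h (WithTop.coe_le_coe.mpr hy))
  · intro h y hy
    lift y to P using (hy.trans_lt (WithTop.coe_lt_top x)).ne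
    exact WithTop.coe_le_coe.mpr (h (WithTop.coe_le_coe.mp hy))

theorem toHat_lt_top (x : P) : toHat x < ⊤ := by
  rw [toHat, show (⊤ : HatPoset P) = ((⊤ : WithTop P) : WithBot (WithTop P)) from rfl,
    WithBot.coe_lt_coe]
  exact WithTop.coe_lt_top x

theorem bot_lt_toHat (x : P) : ⊥ < toHat x := WithBot.bot_lt_coe _

end Hat

/-! ### The order of words through linearly ordered keys -/

section WordOrder

variable {m n ℓ a : ℕ}

/-- The exponent `j` of an element `ω^j` of `μ_m`. -/
noncomputable def colorIndex (m : ℕ) (δ : ℂ) : ℕ :=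
  sInf {j | Complex.exp (2 * Real.pi * Complex.I / m) ^ j = δ}

theorem colorIndex_pow (hm : 0 < m) {j : ℕ} (hj : j < m) :
    colorIndex m (Complex.exp (2 * Real.pi * Complex.I / m) ^ j) = j := by
  have hω := Complex.isPrimitiveRoot_exp m hm.ne'
  set ω := Complex.exp (2 * Real.pi * Complex.I / m) with hω'
  rw [colorIndex, ← hω']
  have h1 : sInf {i | ω ^ i = ω ^ j} ≤ j := Nat.sInf_le rfl
  have h2 : ω ^ sInf {i | ω ^ i = ω ^ j} = ω ^ j := Nat.sInf_mem (s := {i | ω ^ i = ω ^ j}) ⟨j, rfl⟩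
  exact hω.pow_inj (h1.trans_lt hj) hj h2

theorem exists_eq_pow (hm : 0 < m) {δ : ℂ} (hδ : δ ^ m = 1) :
    ∃ j < m, δ = Complex.exp (2 * Real.pi * Complex.I / m) ^ j := by
  have : NeZero m := ⟨hm.ne'⟩
  obtain ⟨j, hj, h⟩ := (Complex.isPrimitiveRoot_exp m hm.ne').eq_pow_of_pow_eq_one hδ
  exact ⟨j, hj, h.symm⟩

theorem colorLT_iff (hm : 0 < m) {δ ε : ℂ} (hδ : δ ^ m = 1) (hε : ε ^ m = 1) :
    ColoredCycle.ColorLT m δ ε ↔ colorIndex m δ < colorIndex m ε := by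
  constructor
  · rintro ⟨j, k, hjk, hk, rfl, rfl⟩
    rwa [colorIndex_pow hm (hjk.trans hk), colorIndex_pow hm hk]
  · intro h
    obtain ⟨j, hj, rfl⟩ := exists_eq_pow hm hδ
    obtain ⟨k, hk, rfl⟩ := exists_eq_pow hm hε
    rw [colorIndex_pow hm hj, colorIndex_pow hm hk] at h
    exact ⟨j, k, h, hk, rfl, rfl⟩

theorem colorIndex_inj (hm : 0 < m) {δ ε : ℂ} (hδ : δ ^ m = 1) (hε : ε ^ m = 1) :
    colorIndex m δ = colorIndex m ε ↔ δ = ε := by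
  refine ⟨fun h => ?_, fun h => by rw [h]⟩
  obtain ⟨j, hj, rfl⟩ := exists_eq_pow hm hδ
  obtain ⟨k, hk, rfl⟩ := exists_eq_pow hm hε
  rw [colorIndex_pow hm hj, colorIndex_pow hm hk] at h
  rw [h]

/-- The sort key of a column of a cycle. -/
noncomputable def ColoredCycle.columnKey (σ : ColoredCycle m n ℓ) (k : Fin ℓ) :
    Fin n ×ₗ (Fin n ×ₗ ℕ) :=
  toLex (σ.pt k, toLex (σ.pt (finRotate ℓ k), colorIndex m (σ.col k)))

theorem ColoredCycle.columnKey_inj (hm : 0 < m) {σ τ : ColoredCycle m n ℓ} {k : Fin ℓ} :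
    σ.columnKey k = τ.columnKey k ↔ σ.column k = τ.column k := by
  simp only [columnKey, column, toLex_inj, Prod.mk.injEq,
    colorIndex_inj hm (σ.col_pow k) (τ.col_pow k)]

theorem ColoredCycle.columnKey_lt (hm : 0 < m) {σ τ : ColoredCycle m n ℓ} {k : Fin ℓ} :
    σ.columnKey k < τ.columnKey k ↔ ColumnLT m (σ.column k) (τ.column k) := by
  simp only [columnKey, column, ColumnLT, Prod.Lex.toLex_lt_toLex,
    colorLT_iff hm (σ.col_pow k) (τ.col_pow k)]
  tauto

/-- The sort key of a cycle. -/
noncomputable def ColoredCycle.key (σ : ColoredCycle m n ℓ) :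
    Lex (Fin ℓ → Fin n ×ₗ (Fin n ×ₗ ℕ)) := toLex σ.columnKey

theorem ColoredCycle.key_injective (hm : 0 < m) :
    Function.Injective (ColoredCycle.key : ColoredCycle m n ℓ → _) := by
  intro σ τ h
  have h1 : ∀ k, σ.column k = τ.column k := fun k => (columnKey_inj hm).mp (congrFun h k)
  ext k
  · exact congrArg (fun c => (c.1 : ℕ)) (h1 k)
  · exact congrArg (fun c => c.2.2) (h1 k)

theorem ColoredCycle.key_lt (hm : 0 < m) {σ τ : ColoredCycle m n ℓ} :
    σ.key < τ.key ↔ σ.LexLT τ := by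
  change (∃ k, (∀ i, i < k → σ.columnKey i = τ.columnKey i) ∧ σ.columnKey k < τ.columnKey k) ↔ _
  simp only [columnKey_inj hm, columnKey_lt hm, LexLT]

/-- The sort key of a word. -/
noncomputable def EigenWord.key (w : EigenWord m n ℓ a) :
    Lex (Fin (n - a * ℓ) → Fin n) ×ₗ Lex (Fin a → Lex (Fin ℓ → Fin n ×ₗ (Fin n ×ₗ ℕ))) :=
  toLex (toLex w.fixed, toLex fun j => (w.cycles j).key)

theorem EigenWord.key_injective (hm : 0 < m) :
    Function.Injective (EigenWord.key : EigenWord m n ℓ a → _) := by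
  intro w w' h
  simp only [key, toLex_inj, Prod.mk.injEq] at h
  apply EigenWord.ext h.1
  funext j
  exact ColoredCycle.key_injective hm (congrFun h.2 j)

/-- The keys lie in a lexicographic linear order, so together with `key_injective` this makes the
comparison of words a strict linear order. -/
theorem EigenWord.key_lt (hm : 0 < m) {w w' : EigenWord m n ℓ a} :
    w.key < w'.key ↔ w.LexLT w' := by
  rw [key, key, Prod.Lex.toLex_lt_toLex, toLex_inj]
  change ((∃ i, (∀ j, j < i → w.fixed j = w'.fixed j) ∧ w.fixed i < w'.fixed i) ∨
    (w.fixed = w'.fixed ∧ ∃ i, (∀ j, j < i → (w.cycles j).key = (w'.cycles j).key) ∧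
      (w.cycles i).key < (w'.cycles i).key)) ↔ _
  simp only [(ColoredCycle.key_injective hm).eq_iff, ColoredCycle.key_lt hm, LexLT]

/-- Of two increasing sequences, the one whose range contains the first element in which the ranges
differ is lexicographically smaller. -/
theorem exists_lt_of_strictMono {N : ℕ} {A B : Fin N → Fin n} (hA : StrictMono A)
    (hB : StrictMono B) {f : Fin n} (hfA : f ∈ Set.range A) (hfB : f ∉ Set.range B)
    (h : ∀ i < f, i ∈ Set.range A ↔ i ∈ Set.range B) :
    ∃ i, (∀ j < i, A j = B j) ∧ A i < B i := by
  obtain ⟨i, rfl⟩ := hfA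
  -- Below f = A i both sequences enumerate the same elements in increasing order.
  have key : ∀ k < i, A k = B k := by
    intro k
    induction k using WellFoundedLT.induction with
    | ind k ih =>
      intro hk
      have h1 : B k ≤ A k := by
        obtain ⟨k₁, hk₁⟩ := (h (A k) (hA hk)).mp ⟨k, rfl⟩
        rw [← hk₁]
        apply hB.monotone
        by_contra hlt
        rw [not_le] at hlt
        rw [← ih k₁ hlt (hlt.trans hk)] at hk₁
        exact hlt.ne (hA.injective hk₁)
      obtain ⟨k₂, hk₂⟩ := (h (B k) (h1.trans_lt (hA hk))).mpr ⟨k, rfl⟩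
      refine le_antisymm ?_ h1
      rw [← hk₂]
      apply hA.monotone
      by_contra hlt
      rw [not_le] at hlt
      rw [ih k₂ hlt (hlt.trans hk)] at hk₂
      exact hlt.ne (hB.injective hk₂)
  refine ⟨i, key, ?_⟩
  rcases lt_trichotomy (A i) (B i) with h1 | h1 | h1
  · exact h1
  · exact absurd ⟨i, h1.symm⟩ hfB
  · obtain ⟨k, hk⟩ := (h (B i) h1).mpr ⟨i, rfl⟩
    have hki : k < i := hA.lt_iff_lt.mp (by rwa [hk])
    rw [key k hki] at hk
    exact absurd (hB.injective hk) hki.ne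

end WordOrder

/-! ### Recovering a word from the relations valid on its eigenspace -/

/-- `w` is a word of `E`, and no coordinate in the support of a cycle vanishes on `E`. -/
structure EigenWord.IsFullWordOf {m n ℓ a : ℕ} (ζ : ℂ) (w : EigenWord m n ℓ a)
    (E : Submodule ℂ (Fin n → ℂ)) : Prop where
  word : w.IsWordOf ζ E
  full : ∃ y ∈ E, ∀ q k, y ((w.cycles q).pt k) ≠ 0

namespace EigenWord

variable {m p d n a : ℕ} {ζ : ℂ} {E E' : Submodule ℂ (Fin n → ℂ)}
  {w w' : EigenWord m n (cycleLength m d) a}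

theorem IsWordOf.relation (h : EigenSetup m p d ζ) (hw : w.IsWordOf ζ E) {x : Fin n → ℂ}
    (hx : x ∈ E) (q : Fin a) (k : Fin (cycleLength m d)) :
    (w.cycles q).col k * x ((w.cycles q).pt k) = ζ * x ((w.cycles q).pt (finRotate _ k)) := by
  rw [hw.eq_space h.ne_one] at hx
  exact hx.2 q k

/-- The vector `F.embed 1` is nonzero exactly on the blocks of F and vanishes outside the cycles of
w. Both supports have a ℓ elements, so they coincide. -/
theorem IsWordOf.isFullWordOf (h : EigenSetup m p d ζ) (hw : w.IsWordOf ζ E)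
    (F : BlockFrame m n (cycleLength m d) ζ (Fin a)) (hF : E = F.space) : w.IsFullWordOf ζ E := by
  classical
  refine ⟨hw, F.embed 1, ?_, ?_⟩
  · rw [hF, ← F.range_embed h.cycleLength_pos]
    exact ⟨1, rfl⟩
  · have hmem : F.embed 1 ∈ w.space ζ := by
      rw [← hw.eq_space h.ne_one, hF, ← F.range_embed h.cycleLength_pos]
      exact ⟨1, rfl⟩
    let A : Finset (Fin n) := Finset.univ.image fun x : Fin a × Fin (cycleLength m d) =>
      F.pt x.1 x.2
    let B : Finset (Fin n) := Finset.univ.biUnion fun q => (w.cycles q).supp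
    have hA : A.card = a * cycleLength m d := by
      simp [A, Finset.card_image_of_injective _ F.pt_injective]
    have hB : B.card = a * cycleLength m d := by
      simp only [B]
      rw [Finset.card_biUnion fun i _ j _ hij => hw.disjoint i j hij]
      simp [ColoredCycle.card_supp]
    have hAB : A ⊆ B := by
      intro i hi
      obtain ⟨⟨j, s⟩, -, rfl⟩ := Finset.mem_image.mp hi
      by_contra hcon
      have h1 := hmem.1 (F.pt j s) (by simpa [B] using hcon)
      rw [F.embed_apply] at h1
      simp [F.val_ne_zero] at h1
    have hAB' : A = B := Finset.eq_of_subset_of_card_le hAB (by rw [hA, hB])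
    intro q k
    have h1 : (w.cycles q).pt k ∈ A := by
      rw [hAB']
      exact Finset.mem_biUnion.mpr ⟨q, Finset.mem_univ _, (w.cycles q).pt_mem_supp k⟩
    obtain ⟨⟨j, s⟩, -, hjs⟩ := Finset.mem_image.mp h1
    rw [← hjs]
    simp only
    rw [F.embed_apply]
    simp [F.val_ne_zero]

theorem IsFullWordOf.mem_range_fixed_iff (h : EigenSetup m p d ζ) (hw : w.IsFullWordOf ζ E)
    {i : Fin n} : i ∈ Set.range w.fixed ↔ ∀ x ∈ E, x i = 0 := by
  rw [← hw.word.notMem_supp_iff]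
  constructor
  · intro hi x hx
    rw [hw.word.eq_space h.ne_one] at hx
    exact hx.1 i hi
  · intro hi q hq
    obtain ⟨k, rfl⟩ := ColoredCycle.mem_supp.mp hq
    obtain ⟨y, hy, hy'⟩ := hw.full
    exact hy' q k (hi y hy)

theorem IsWordOf.pt_notMem_range_fixed (hw : w.IsWordOf ζ E) (q : Fin a)
    (k : Fin (cycleLength m d)) : (w.cycles q).pt k ∉ Set.range w.fixed := by
  rw [hw.range_fixed]
  exact fun hk => hk q ((w.cycles q).pt_mem_supp k)

/-- Taking m-th powers removes the colors, so the m-th power of an entry records only its position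
on the cycle. -/
theorem IsWordOf.pow_mul_pt_pow (h : EigenSetup m p d ζ) (hw : w.IsWordOf ζ E)
    {x : Fin n → ℂ} (hx : x ∈ E) (q : Fin a) (k : ℕ) (hk : k < cycleLength m d) :
    (ζ ^ m) ^ k * x ((w.cycles q).pt ⟨k, hk⟩) ^ m =
      x ((w.cycles q).pt ⟨0, h.cycleLength_pos⟩) ^ m := by
  induction k with
  | zero => simp
  | succ k ih =>
    rw [← ih (by omega)]
    have h1 := congrArg (· ^ m) (hw.relation h hx q ⟨k, by omega⟩)
    simp only [mul_pow, (w.cycles q).col_pow, one_mul] at h1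
    rw [finRotate_mk hk] at h1
    rw [h1, pow_succ, mul_assoc]

/-- On a maximal eigenspace, every coordinate of the support has a unique successor and color. -/
theorem IsFullWordOf.succ_unique (h : EigenSetup m p d ζ) (hw : w.IsFullWordOf ζ E) {q : Fin a}
    {k : Fin (cycleLength m d)} {i : Fin n} {δ : ℂ} (hδ : δ ^ m = 1)
    (hr : ∀ x ∈ E, δ * x ((w.cycles q).pt k) = ζ * x i) :
    i = (w.cycles q).pt (finRotate _ k) ∧ δ = (w.cycles q).col k := by
  obtain ⟨y, hy, hy0⟩ := hw.full
  have hδ0 := ne_zero_of_pow_eq_one h.pos hδ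
  -- Restricting y to the q-th cycle gives a vector of E with nonzero left side, so i cannot lie
  -- outside that cycle.
  have hi : i ∈ (w.cycles q).supp := by
    by_contra hi
    have hz := restrict_mem_eigen h.ne_one (hw.word.eq_space h.ne_one ▸ hy) q
    have hz' := hr _ (hw.word.sum_eq ▸ Submodule.mem_iSup_of_mem q hz)
    simp only [ColoredCycle.pt_mem_supp, if_true, hi, if_false, mul_zero] at hz'
    exact mul_ne_zero hδ0 (hy0 q k) hz'
  obtain ⟨k', rfl⟩ := ColoredCycle.mem_supp.mp hi
  have h1 := hr y hy
  have h2 := hw.word.relation h hy q k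
  have h3 := congrArg (· ^ m) h1
  have h4 := congrArg (· ^ m) h2
  simp only [mul_pow, (w.cycles q).col_pow, hδ, one_mul] at h3 h4
  rw [h3] at h4
  -- The entries at i and at the true successor have equal m-th powers; as ζ^m has order ℓ, the
  -- positions agree.
  have h5 := mul_left_cancel₀ (pow_ne_zero m h.ne_zero) h4
  have h6 := hw.word.pow_mul_pt_pow h hy q k' k'.2
  have h7 := hw.word.pow_mul_pt_pow h hy q (finRotate _ k : Fin _) (finRotate _ k).2
  rw [← h7, Fin.eta, Fin.eta, h5] at h6
  have h8 := h.pow_prim.pow_inj k'.2 (finRotate _ k).2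
    (mul_right_cancel₀ (pow_ne_zero m (hy0 q _)) h6)
  have h9 : k' = finRotate _ k := Fin.ext h8
  refine ⟨by rw [h9], ?_⟩
  rw [h9, ← h2] at h1
  exact mul_right_cancel₀ (hy0 q k) h1

/-- Multiply the relations around the cycle; the entries of y cancel. Consequently the last color is
determined by the others. -/
theorem IsFullWordOf.prod_col (h : EigenSetup m p d ζ) (hw : w.IsFullWordOf ζ E) (q : Fin a) :
    ∏ k, (w.cycles q).col k = ζ ^ cycleLength m d := by
  obtain ⟨y, hy, hy0⟩ := hw.full
  have h1 : ∏ k, ((w.cycles q).col k * y ((w.cycles q).pt k)) =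
      ∏ k, (ζ * y ((w.cycles q).pt (finRotate _ k))) :=
    Finset.prod_congr rfl fun k _ => hw.word.relation h hy q k
  rw [Finset.prod_mul_distrib, Finset.prod_mul_distrib,
    Equiv.prod_comp (finRotate _) (fun k => y ((w.cycles q).pt k))] at h1
  rw [mul_right_cancel₀ (Finset.prod_ne_zero_iff.mpr fun k _ => hy0 q k) h1]
  simp

/-- The first entry of a cycle is the smallest element outside the preceding cycles. -/
theorem IsWordOf.pt_zero_le (h : EigenSetup m p d ζ) (hw : w.IsWordOf ζ E)
    (hw' : w'.IsWordOf ζ E') (hfix : Set.range w.fixed = Set.range w'.fixed) {q : Fin a}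
    (hq : ∀ j < q, w'.cycles j = w.cycles j) :
    (w'.cycles q).pt ⟨0, h.cycleLength_pos⟩ ≤ (w.cycles q).pt ⟨0, h.cycleLength_pos⟩ := by
  have h1 := hw.pt_notMem_range_fixed q ⟨0, h.cycleLength_pos⟩
  -- The first entry of the q-th cycle of w lies in some cycle q' of w'. Since the earlier cycles
  -- agree, q ≤ q', and the minima of the cycles of w' increase.
  rw [hfix, ← hw'.notMem_supp_iff] at h1
  push Not at h1
  obtain ⟨q', hq'⟩ := h1
  have h2 : q ≤ q' := by
    by_contra hlt
    rw [not_le] at hlt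
    rw [hq q' hlt] at hq'
    exact Finset.disjoint_left.mp (hw.disjoint q q' hlt.ne') ((w.cycles q).pt_mem_supp _) hq'
  have h3 := Finset.min_le hq'
  refine WithTop.coe_le_coe.mp (le_trans ?_ h3)
  rw [← ColoredCycle.min_supp]
  rcases h2.eq_or_lt with rfl | h2
  · exact le_rfl
  · exact (hw'.cycles_sorted q q' h2).le

theorem IsWordOf.pt_zero_eq (h : EigenSetup m p d ζ) (hw : w.IsWordOf ζ E)
    (hw' : w'.IsWordOf ζ E') (hfix : Set.range w.fixed = Set.range w'.fixed) {q : Fin a}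
    (hq : ∀ j < q, w'.cycles j = w.cycles j) :
    (w'.cycles q).pt ⟨0, h.cycleLength_pos⟩ = (w.cycles q).pt ⟨0, h.cycleLength_pos⟩ :=
  le_antisymm (hw.pt_zero_le h hw' hfix hq)
    (hw'.pt_zero_le h hw hfix.symm fun j hj => (hq j hj).symm)

theorem IsFullWordOf.pt_eq_of_relation (h : EigenSetup m p d ζ) (hw : w.IsFullWordOf ζ E)
    {q : Fin a} {σ : ColoredCycle m n (cycleLength m d)}
    (h0 : (w.cycles q).pt ⟨0, h.cycleLength_pos⟩ = σ.pt ⟨0, h.cycleLength_pos⟩) (K : ℕ)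
    (hK : K < cycleLength m d)
    (hr : ∀ k : Fin (cycleLength m d), (k : ℕ) < K → ∀ x ∈ E,
      σ.col k * x (σ.pt k) = ζ * x (σ.pt (finRotate _ k))) :
    (w.cycles q).pt ⟨K, hK⟩ = σ.pt ⟨K, hK⟩ := by
  induction K with
  | zero => exact h0
  | succ K ih =>
    have h1 := ih (by omega) fun k hk => hr k (by omega)
    have h2 := hr ⟨K, by omega⟩ (by simp)
    rw [← h1] at h2
    have h3 := (hw.succ_unique h (σ.col_pow _) h2).1
    rw [finRotate_mk hK] at h3
    exact h3.symm

theorem IsFullWordOf.column_eq_of_relation (h : EigenSetup m p d ζ) (hw : w.IsFullWordOf ζ E)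
    {q : Fin a} {σ : ColoredCycle m n (cycleLength m d)} {k : Fin (cycleLength m d)}
    (hk : (w.cycles q).pt k = σ.pt k)
    (hr : ∀ x ∈ E, σ.col k * x (σ.pt k) = ζ * x (σ.pt (finRotate _ k))) :
    (w.cycles q).column k = σ.column k := by
  rw [← hk] at hr
  have h3 := hw.succ_unique h (σ.col_pow _) hr
  simp only [ColoredCycle.column, hk, h3.1, h3.2]

/-- Earlier cycles and fixed entries determine where the next cycle starts; from there `succ_unique`
forces each next entry and color. -/
theorem IsFullWordOf.cycles_eq_of_relation (h : EigenSetup m p d ζ) (hw : w.IsWordOf ζ E)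
    (hw' : w'.IsFullWordOf ζ E') (hfix : Set.range w.fixed = Set.range w'.fixed) (q : Fin a)
    (hr : ∀ j ≤ q, ∀ k, ∀ x ∈ E', (w.cycles j).col k * x ((w.cycles j).pt k) =
      ζ * x ((w.cycles j).pt (finRotate _ k))) : w'.cycles q = w.cycles q := by
  induction q using WellFoundedLT.induction with
  | ind q ih =>
    have hq : ∀ j < q, w'.cycles j = w.cycles j := fun j hj =>
      ih j hj fun i hi => hr i (hi.trans hj.le)
    have h0 := hw.pt_zero_eq h hw'.word hfix hq
    apply ColoredCycle.key_injective h.pos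
    funext k
    refine (ColoredCycle.columnKey_inj h.pos).mpr (hw'.column_eq_of_relation h ?_ (hr q le_rfl k))
    exact hw'.pt_eq_of_relation h h0 k k.2 fun k' _ => hr q le_rfl k'

theorem IsFullWordOf.eq (h : EigenSetup m p d ζ) (hw : w.IsFullWordOf ζ E)
    (hw' : w'.IsFullWordOf ζ E) : w = w' := by
  have hfix : Set.range w.fixed = Set.range w'.fixed := by
    ext i
    rw [hw.mem_range_fixed_iff h, hw'.mem_range_fixed_iff h]
  apply EigenWord.ext
  · exact (StrictMono.range_inj hw.word.fixed_strictMono hw'.word.fixed_strictMono).mp hfix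
  · funext q
    exact (hw'.cycles_eq_of_relation h hw.word hfix q fun j _ k x hx =>
      hw.word.relation h hx j k).symm

/-- A criterion for `word(E') < word(E)` when `E` and `E'` have the same support. -/
theorem IsFullWordOf.lexLT_of_relation (h : EigenSetup m p d ζ) (hw : w.IsWordOf ζ E)
    (hw' : w'.IsFullWordOf ζ E') (hfix : Set.range w.fixed = Set.range w'.fixed) (q : Fin a)
    (hr : ∀ j < q, ∀ k, ∀ x ∈ E', (w.cycles j).col k * x ((w.cycles j).pt k) =
      ζ * x ((w.cycles j).pt (finRotate _ k))) (k : Fin (cycleLength m d))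
    (hrk : ∀ k' < k, ∀ x ∈ E', (w.cycles q).col k' * x ((w.cycles q).pt k') =
      ζ * x ((w.cycles q).pt (finRotate _ k'))) {t : Fin n} {ε : ℂ} (hε : ε ^ m = 1)
    (ht : ∀ x ∈ E', ε * x ((w.cycles q).pt k) = ζ * x t)
    (hlt : ColoredCycle.ColumnLT m ((w.cycles q).pt k, t, ε) ((w.cycles q).column k)) :
    w'.LexLT w := by
  have hq : ∀ j < q, w'.cycles j = w.cycles j := fun j hj =>
    hw'.cycles_eq_of_relation h hw hfix j fun i hi => hr i (hi.trans_lt hj)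
  have h0 := hw.pt_zero_eq h hw'.word hfix hq
  have hpt : ∀ k' ≤ k, (w'.cycles q).pt k' = (w.cycles q).pt k' := fun k' hk' =>
    hw'.pt_eq_of_relation h h0 k' k'.2 fun k'' hk'' => hrk k'' (lt_of_lt_of_le hk'' hk')
  refine Or.inr ⟨?_, q, hq, k, fun k' hk' => ?_, ?_⟩
  · exact (StrictMono.range_inj hw'.word.fixed_strictMono hw.fixed_strictMono).mp hfix.symm
  · exact hw'.column_eq_of_relation h (hpt k' hk'.le) (hrk k' hk')
  · rw [← hpt k le_rfl] at ht hlt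
    -- The k-th column of w' can only be the one given by t and ε.
    have h1 := hw'.succ_unique h hε ht
    rw [h1.1, h1.2] at hlt
    exact hlt

end EigenWord

/-! ### The exchange property at the bottom element -/

theorem finrank_comap_of_injective {V : Type*} [AddCommGroup V] [Module ℂ V]
    [FiniteDimensional ℂ V] {T : V →ₗ[ℂ] V} (hT : Function.Injective T) (X : Submodule ℂ V) :
    Module.finrank ℂ ↥(X.comap T) = Module.finrank ℂ X := by
  have h : X.comap T = _ :=
    Submodule.comap_equiv_eq_map_symm (LinearEquiv.ofInjectiveEndo T hT) X
  rw [h]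
  exact LinearEquiv.finrank_map_eq _ _

theorem finRotate_eq_zero {ℓ : ℕ} {k : Fin ℓ} (hk : (k : ℕ) + 1 = ℓ) :
    finRotate ℓ k = ⟨0, k.pos⟩ := by
  obtain ⟨r, rfl⟩ : ∃ r, ℓ = r + 1 := ⟨ℓ - 1, by omega⟩
  rw [show k = Fin.last r from Fin.ext (by simpa using hk), finRotate_last]
  rfl

namespace EigenspacePoset

variable {m p d n : ℕ} {ζ : ℂ}

theorem isFullWordOf (h : EigenSetup m p d ζ) {E : EigenspacePoset (monomialGroup m p n) ζ}
    (hE : IsMin E) {w : EigenWord m n (cycleLength m d) (numDegreesDvd m p n d)}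
    (hw : w.IsWordOf ζ E.space) : w.IsFullWordOf ζ E.space := by
  obtain ⟨F, hF⟩ := exists_frame h hE
  exact hw.isFullWordOf h F hF

theorem exists_isFullWordOf (h : EigenSetup m p d ζ)
    {E : EigenspacePoset (monomialGroup m p n) ζ} (hE : IsMin E) :
    ∃ w : EigenWord m n (cycleLength m d) (numDegreesDvd m p n d), w.IsFullWordOf ζ E.space := by
  obtain ⟨F, hF⟩ := exists_frame h hE
  obtain ⟨w, hw⟩ := F.exists_word h.cycleLength_pos h.ne_zero h.ne_one h.pow_prim.pow_eq_one
  exact ⟨w, isFullWordOf h hE (hF ▸ hw)⟩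

theorem existsUnique_isWordOf (h : EigenSetup m p d ζ)
    {E : EigenspacePoset (monomialGroup m p n) ζ} (hE : IsMin E) :
    ∃! w : EigenWord m n (cycleLength m d) (numDegreesDvd m p n d), w.IsWordOf ζ E.space := by
  obtain ⟨w, hw⟩ := exists_isFullWordOf h hE
  exact ⟨w, hw.word, fun w' hw' => (isFullWordOf h hE hw').eq h hw⟩

/-- Moving a maximal eigenspace `E` by an element of `G(m,1,n)` that fixes the intersection of `E`
with a reflecting hyperplane pointwise. -/
theorem exists_transfer (h : EigenSetup m p d ζ) {E X : EigenspacePoset (monomialGroup m p n) ζ}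
    (hE : IsMin E) (hEX : E ≤ X) (τ : Equiv.Perm (Fin n)) {b : Fin n → ℂ}
    (hb : ∀ i, b i ^ m = 1) {φ : (Fin n → ℂ) →ₗ[ℂ] ℂ} (hφ : IsReflecting m p ζ φ)
    (hφE : ∃ x ∈ E.space, φ x ≠ 0) (hφX : ∀ x ∈ X.space, φ x = 0)
    (hfix : ∀ x ∈ E.space, φ x = 0 → scalePerm τ b x = x) :
    ∃ E' Y : EigenspacePoset (monomialGroup m p n) ζ, IsMin E' ∧
      (∀ x, x ∈ E'.space ↔ scalePerm τ b x ∈ E.space) ∧ E ⋖ Y ∧ E' < Y ∧ Y ≤ X := by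
  have hb0 : ∀ i, b i ≠ 0 := fun i => ne_zero_of_pow_eq_one h.pos (hb i)
  -- A preimage of E under an element of G(m,1,n). It is again an eigenspace, of the same dimension,
  -- hence maximal.
  let E' : EigenspacePoset (monomialGroup m p n) ζ :=
    ofSpace h ((E.isMonomialEigenspace h).comap_scalePerm h.pos τ hb)
  have hrank : Module.finrank ℂ E'.space = Module.finrank ℂ E.space :=
    finrank_comap_of_injective (scalePerm_injective hb0) _
  have hcov := covBy_inter h hφ hφE
  refine ⟨E', inter h E hφ, isMin_of_finrank h (hrank.trans (finrank_of_isMin h hE)),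
    fun x => Iff.rfl, hcov, lt_of_le_of_ne (le_iff.mpr fun x hx => ?_) fun heq => ?_,
    le_iff.mpr (le_inf (le_iff.mp hEX) hφX)⟩
  · change scalePerm τ b x ∈ E.space
    rw [hfix x hx.1 hx.2]
    exact hx.1
  · have h1 := finrank_of_covBy h hcov
    rw [← heq, hrank] at h1
    omega

/-- The exchange property of the lexicographic order on maximal eigenspaces. -/
theorem exists_exchange (h : EigenSetup m p d ζ) {E F X : EigenspacePoset (monomialGroup m p n) ζ}
    (hE : IsMin E) {w v : EigenWord m n (cycleLength m d) (numDegreesDvd m p n d)}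
    (hw : w.IsFullWordOf ζ E.space) (hv : v.IsFullWordOf ζ F.space) (hvw : v.LexLT w)
    (hEX : E ≤ X) (hFX : F ≤ X) :
    ∃ E' Y : EigenspacePoset (monomialGroup m p n) ζ, IsMin E' ∧
      (∃ w' : EigenWord m n (cycleLength m d) (numDegreesDvd m p n d),
        w'.IsFullWordOf ζ E'.space ∧ w'.LexLT w) ∧ E ⋖ Y ∧ E' < Y ∧ Y ≤ X := by
  rcases hvw with ⟨i, hi, hlt⟩ | ⟨hfixed, q, hq, k, hk, hlt⟩
  · -- the fixed entries differ: swap the first new one with the one it replaces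
    set f := v.fixed i
    set s := w.fixed i
    have hfv : f ∈ Set.range v.fixed := ⟨i, rfl⟩
    have hsw : s ∈ Set.range w.fixed := ⟨i, rfl⟩
    -- The entries of w before position i are entries of v below f, and those from i on are at least
    -- s > f.
    have hfw : f ∉ Set.range w.fixed := by
      rintro ⟨k, hk⟩
      rcases lt_or_ge k i with hki | hki
      · rw [← hi k hki] at hk
        exact hki.ne (hv.word.fixed_strictMono.injective hk)
      · have := hw.word.fixed_strictMono.monotone hki
        rw [hk] at this
        exact absurd hlt (not_lt.mpr this)
    obtain ⟨x₀, hx₀, hx₀f⟩ : ∃ x ∈ E.space, x f ≠ 0 := by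
      rw [hw.mem_range_fixed_iff h] at hfw
      push Not at hfw
      exact hfw
    have hsE := (hw.mem_range_fixed_iff h).mp hsw
    have hfF := (hv.mem_range_fixed_iff h).mp hfv
    obtain ⟨E', Y, hE', hmem, hY⟩ := exists_transfer h hE hEX (Equiv.swap f s)
      (b := fun _ => 1) (by simp) (isReflecting_diff h hlt.ne (κ := 1) (one_pow m))
      ⟨x₀, hx₀, by simpa [hsE x₀ hx₀] using hx₀f⟩
      (fun x hx => by simp [hfF x (hFX hx), hsE x (hEX hx)])
      (fun x hx hφ => by
        rw [diffFunctional_apply, one_mul, hsE x hx, sub_zero] at hφ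
        ext j
        simp only [scalePerm_apply, one_mul]
        rw [Equiv.swap_apply_def]
        split_ifs with h1 h2
        · rw [h1, hφ, hsE x hx]
        · rw [h2, hφ, hsE x hx]
        · rfl)
    obtain ⟨w', hw'⟩ := exists_isFullWordOf h hE'
    refine ⟨E', Y, hE', ⟨w', hw', Or.inl ?_⟩, hY⟩
    -- The fixed set of E' has f in place of s and is unchanged below f, so its word is smaller.
    have hrange : ∀ j, j ∈ Set.range w'.fixed ↔ Equiv.swap f s j ∈ Set.range w.fixed := by
      intro j
      rw [hw'.mem_range_fixed_iff h, hw.mem_range_fixed_iff h]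
      constructor
      · intro hj x hx
        have h1 := hj (scalePerm (Equiv.swap f s) (fun _ => 1) x) ((hmem _).mpr (by
          convert hx using 1
          ext i
          simp))
        simpa using h1
      · intro hj x hx
        have h1 := hj _ ((hmem x).mp hx)
        simpa using h1
    apply exists_lt_of_strictMono hw'.word.fixed_strictMono hw.word.fixed_strictMono (f := f)
    · rw [hrange, Equiv.swap_apply_left]; exact hsw
    · exact hfw
    · intro j hj
      rw [hrange, Equiv.swap_apply_of_ne_of_ne hj.ne (hj.trans hlt).ne]
  · -- the cycles differ: the first new column determines the group element
    set σ := w.cycles q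
    set τ := v.cycles q
    have h0 : τ.pt ⟨0, h.cycleLength_pos⟩ = σ.pt ⟨0, h.cycleLength_pos⟩ :=
      hw.word.pt_zero_eq h hv.word (by rw [hfixed]) hq
    have hpt : ∀ k' ≤ k, τ.pt k' = σ.pt k' := by
      rintro ⟨k', hk'⟩ hle
      rcases k' with _ | k'
      · exact h0
      · have h1 := congrArg (fun c => c.2.1) (hk ⟨k', by omega⟩ (lt_of_lt_of_le (Fin.lt_def.mpr (Nat.lt_succ_self _)) hle))
        simp only [ColoredCycle.column, finRotate_mk hk'] at h1
        exact h1
    have hcolor : ¬ ColoredCycle.ColorLT m (σ.col k) (σ.col k) := by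
      rw [colorLT_iff h.pos (σ.col_pow k) (σ.col_pow k)]
      exact lt_irrefl _
    -- The difference cannot first occur in the closing column: that column returns to the common
    -- first entry, and its color is forced by `prod_col`.
    have hkℓ : (k : ℕ) + 1 < (cycleLength m d) := by
      by_contra hcon
      have hlast : ∀ k', k' ≠ k → k' < k := fun k' hk' => by
        have := k'.2
        exact lt_of_le_of_ne (Fin.le_def.mpr (by omega)) hk'
      have hrot : finRotate (cycleLength m d) k = ⟨0, h.cycleLength_pos⟩ :=
        finRotate_eq_zero (by have := k.2; omega)
      have hcol : τ.col k = σ.col k := by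
        have h1 := (hv.prod_col h q).trans (hw.prod_col h q).symm
        rw [← Finset.mul_prod_erase _ _ (Finset.mem_univ k),
          ← Finset.mul_prod_erase _ (fun k => (w.cycles q).col k) (Finset.mem_univ k)] at h1
        have h2 : ∏ k' ∈ Finset.univ.erase k, τ.col k' = ∏ k' ∈ Finset.univ.erase k, σ.col k' :=
          Finset.prod_congr rfl fun k' hk' =>
            congrArg (fun c => c.2.2) (hk k' (hlast k' (Finset.ne_of_mem_erase hk')))
        change τ.col k * ∏ k' ∈ Finset.univ.erase k, τ.col k' =
          σ.col k * ∏ k' ∈ Finset.univ.erase k, σ.col k' at h1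
        rw [h2] at h1
        exact mul_right_cancel₀ (Finset.prod_ne_zero_iff.mpr fun k' _ =>
          ne_zero_of_pow_eq_one h.pos (σ.col_pow k')) h1
      simp only [ColoredCycle.ColumnLT, ColoredCycle.column, hpt k le_rfl, hrot, h0, hcol,
        lt_irrefl, true_and, false_or] at hlt
      exact hcolor hlt
    set ε := τ.col k
    set δ := σ.col k
    set c := σ.pt k with hc
    set u := σ.pt (finRotate (cycleLength m d) k) with hu
    set t := τ.pt (finRotate (cycleLength m d) k) with ht
    have hε : ε ^ m = 1 := τ.col_pow k
    have hδ : δ ^ m = 1 := σ.col_pow k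
    have hε0 := ne_zero_of_pow_eq_one h.pos hε
    have hδ0 := ne_zero_of_pow_eq_one h.pos hδ
    have hEr : ∀ x ∈ E.space, δ * x c = ζ * x u := fun x hx => hw.word.relation h hx q k
    have hFr : ∀ x ∈ F.space, ε * x c = ζ * x t := fun x hx => by
      have := hv.word.relation h hx q k
      rwa [show (v.cycles q).pt k = c from hpt k le_rfl] at this
    have hrotk : k < finRotate (cycleLength m d) k := by
      have h1 := finRotate_mk hkℓ
      rw [Fin.eta] at h1
      rw [h1, Fin.lt_def]
      simp
    have hσu : ∀ k' ≤ k, σ.pt k' ≠ u := fun k' hk' heq =>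
      (lt_of_le_of_lt hk' hrotk).ne (σ.pt_injective heq)
    have hσt : ∀ k' ≤ k, σ.pt k' ≠ t := fun k' hk' heq => by
      rw [← hpt k' hk'] at heq
      exact (lt_of_le_of_lt hk' hrotk).ne (τ.pt_injective heq)
    have hcu : c ≠ u := hσu k le_rfl
    have hct : c ≠ t := hσt k le_rfl
    have hju : ∀ j < q, ∀ k', (w.cycles j).pt k' ≠ u := fun j hj k' heq =>
      hj.ne (EigenWord.eq_of_pt_eq hw.word.disjoint heq).1
    have hjt : ∀ j < q, ∀ k', (w.cycles j).pt k' ≠ t := fun j hj k' heq => by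
      rw [← hq j hj] at heq
      exact hj.ne (EigenWord.eq_of_pt_eq hv.word.disjoint heq).1
    have hfu : u ∉ Set.range w.fixed := hw.word.pt_notMem_range_fixed q _
    have hft : t ∉ Set.range w.fixed := hfixed ▸ hv.word.pt_notMem_range_fixed q _
    -- Shared by both cases below. The map changes only the coordinates t and u, which occur neither
    -- in earlier cycles, nor up to position k of this cycle, nor among the fixed entries. So E'
    -- keeps all earlier relations of E and gains the k-th relation of F.
    have finish : ∀ (ρ : Equiv.Perm (Fin n)) (b : Fin n → ℂ) (φ : (Fin n → ℂ) →ₗ[ℂ] ℂ),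
        (∀ i, b i ^ m = 1) → IsReflecting m p ζ φ → (∃ x ∈ E.space, φ x ≠ 0) →
        (∀ x ∈ X.space, φ x = 0) → (∀ x ∈ E.space, φ x = 0 → scalePerm ρ b x = x) →
        (∀ i, i ≠ t → i ≠ u → ρ i = i ∧ b i = 1) →
        (∀ x, scalePerm ρ b x ∈ E.space → ε * x c = ζ * x t) →
        ∃ E' Y : EigenspacePoset (monomialGroup m p n) ζ, IsMin E' ∧
          (∃ w' : EigenWord m n (cycleLength m d) (numDegreesDvd m p n d),
            w'.IsFullWordOf ζ E'.space ∧ w'.LexLT w) ∧ E ⋖ Y ∧ E' < Y ∧ Y ≤ X := by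
      intro ρ b φ hb hφ hφE hφX hfix hρ hlast
      obtain ⟨E', Y, hE', hmem, hY⟩ := exists_transfer h hE hEX ρ hb hφ hφE hφX hfix
      obtain ⟨w', hw'⟩ := exists_isFullWordOf h hE'
      refine ⟨E', Y, hE', ⟨w', hw', ?_⟩, hY⟩
      have hval : ∀ x i, i ≠ t → i ≠ u → scalePerm ρ b x i = x i := fun x i hit hiu => by
        rw [scalePerm_apply, (hρ i hit hiu).1, (hρ i hit hiu).2, one_mul]
      -- One inclusion suffices, since both words have n - a ℓ fixed entries.
      have hrange : Set.range w.fixed = Set.range w'.fixed := by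
        refine Set.eq_of_subset_of_ncard_le (fun i hi => ?_) ?_ (Set.finite_range _)
        · rw [hw'.mem_range_fixed_iff h]
          intro x hx
          rw [← hval x i (fun heq => hft (heq ▸ hi)) (fun heq => hfu (heq ▸ hi))]
          exact (hw.mem_range_fixed_iff h).mp hi _ ((hmem x).mp hx)
        · rw [← Set.image_univ, ← Set.image_univ,
            Set.ncard_image_of_injective _ hw'.word.fixed_strictMono.injective,
            Set.ncard_image_of_injective _ hw.word.fixed_strictMono.injective]
      refine hw'.lexLT_of_relation h hw.word hrange q (fun j hj k' x hx => ?_) k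
        (fun k' hk' x hx => ?_) hε (fun x hx => hlast x ((hmem x).mp hx)) ?_
      · have h1 := hw.word.relation h ((hmem x).mp hx) j k'
        rwa [hval _ _ (hjt j hj _) (hju j hj _), hval _ _ (hjt j hj _) (hju j hj _)] at h1
      · have h1 := hw.word.relation h ((hmem x).mp hx) q k'
        have h2 : finRotate (cycleLength m d) k' ≤ k := by
          have h3 : (k' : ℕ) + 1 < (cycleLength m d) := by have := Fin.lt_def.mp hk'; omega
          have h4 := finRotate_mk h3
          rw [Fin.eta] at h4
          rw [h4]
          exact hk'
        rwa [hval _ _ (hσt _ hk'.le) (hσu _ hk'.le), hval _ _ (hσt _ h2) (hσu _ h2)] at h1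
      · simpa only [ColoredCycle.column, hpt k le_rfl] using hlt
    have hXr : ∀ x ∈ X.space, x t = ε / δ * x u := fun x hx => by
      have h1 := hEr x (hEX hx)
      have h2 := hFr x (hFX hx)
      apply mul_left_cancel₀ h.ne_zero
      have h3 : ζ * (ε / δ * x u) = ε / δ * (ζ * x u) := by ring
      rw [← h2, h3, ← h1]
      field_simp
    by_cases htu : t = u
    · -- the new column has a smaller color
      have hne : ε ≠ δ := by
        intro heq
        have hlt' : ColoredCycle.ColumnLT m (c, t, ε) (c, u, δ) := by
          simpa only [ColoredCycle.column, hpt k le_rfl] using hlt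
        rcases hlt' with h1 | ⟨-, h1⟩ | ⟨-, -, h1⟩
        · exact lt_irrefl _ h1
        · exact h1.ne htu
        · simp only [heq] at h1
          exact hcolor h1
      -- Otherwise ζ^m = 1 and ℓ = 1, against k + 1 < ℓ.
      have hδζ : δ ≠ ζ := by
        intro heq
        rw [heq] at hδ
        have := h.pow_prim.dvd_of_pow_eq_one 1 (by rw [pow_one, hδ])
        have := Nat.le_of_dvd one_pos this
        omega
      obtain ⟨y, hy, hy0⟩ := hw.full
      -- The hyperplane x_c = x_u is used because `isReflecting_proj` would need m ≠ p for x_u = 0.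
      -- On E the two have the same section, since δ x_c = ζ x_u with δ ≠ ζ.
      refine finish 1 (fun i => if i = u then δ / ε else 1) (diffFunctional c u 1)
        (fun i => ?_) (isReflecting_diff h hcu (one_pow m)) ⟨y, hy, fun hφ => ?_⟩ (fun x hx => ?_)
        (fun x hx hφ => ?_) (fun i _ hi => ⟨rfl, if_neg hi⟩) (fun x hx => ?_)
      · split_ifs
        · rw [div_pow, hδ, hε, div_one]
        · exact one_pow m
      · rw [diffFunctional_apply, one_mul, sub_eq_zero] at hφ
        have h1 := hEr y hy
        rw [hφ] at h1
        exact hδζ (mul_right_cancel₀ (hy0 q _) h1)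
      · have h1 := hXr x hx
        have h2 : (δ - ε) * x u = 0 := by
          rw [htu] at h1
          field_simp at h1
          linear_combination h1
        have h3 := (mul_eq_zero.mp h2).resolve_left (sub_ne_zero.mpr hne.symm)
        have h4 := hEr x (hEX hx)
        rw [h3, mul_zero] at h4
        rw [diffFunctional_apply, h3, (mul_eq_zero.mp h4).resolve_left hδ0]
        simp
      · rw [diffFunctional_apply, one_mul, sub_eq_zero] at hφ
        have h1 := hEr x hx
        rw [hφ] at h1
        have h2 : (δ - ζ) * x u = 0 := by linear_combination h1
        have h3 := (mul_eq_zero.mp h2).resolve_left (sub_ne_zero.mpr hδζ)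
        ext i
        rw [scalePerm_apply, Equiv.Perm.one_apply]
        split_ifs with hi
        · rw [hi, h3, mul_zero]
        · rw [one_mul]
      · have h1 := hEr _ hx
        simp only [scalePerm_apply, Equiv.Perm.one_apply, if_neg hcu, if_true, one_mul] at h1
        rw [htu]
        field_simp at h1
        linear_combination h1
    · -- the new column has a smaller second entry
      have hκ : (ε / δ) ^ m = 1 := by rw [div_pow, hδ, hε, div_one]
      have hut : u ≠ t := fun heq => htu heq.symm
      refine finish (Equiv.swap t u) (fun i => if i = t then ε / δ else if i = u then δ / ε else 1)
        (diffFunctional t u (ε / δ)) (fun i => ?_) (isReflecting_diff h htu hκ) ?_ (fun x hx => ?_)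
        (fun x hx hφ => ?_) (fun i hit hiu => ?_) (fun x hx => ?_)
      · split_ifs
        · exact hκ
        · rw [div_pow, hδ, hε, div_one]
        · exact one_pow m
      -- If E lay in x_t = (ε/δ) x_u, it would satisfy ε x_c = ζ x_t, and t = u by uniqueness of the
      -- successor.
      · by_contra hcon
        push Not at hcon
        apply htu
        refine (hw.succ_unique h (q := q) (k := k) hε fun x hx => ?_).1
        have h1 := hcon x hx
        rw [diffFunctional_apply, sub_eq_zero] at h1
        rw [h1]
        have h2 := hEr x hx
        change ε * x c = _
        have h3 : ζ * (ε / δ * x u) = ε / δ * (ζ * x u) := by ring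
        rw [h3, ← h2]
        field_simp
      · rw [diffFunctional_apply, hXr x hx, sub_self]
      · rw [diffFunctional_apply, sub_eq_zero] at hφ
        ext i
        rw [scalePerm_apply, Equiv.swap_apply_def]
        split_ifs with h1 h2
        · rw [h1, hφ]
        · rw [h2, hφ]; field_simp
        · rw [one_mul]
      · simp only [if_neg hit, if_neg hiu, and_true]
        exact Equiv.swap_apply_of_ne_of_ne hit hiu
      · have h1 := hEr _ hx
        simp only [scalePerm_apply, if_neg hcu, if_neg hct, if_neg hut, if_true, one_mul,
          Equiv.swap_apply_right, Equiv.swap_apply_of_ne_of_ne hct hcu] at h1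
        field_simp at h1
        linear_combination h1

end EigenspacePoset

/-! ### The lexicographic listing and the main theorem -/

namespace EigenspacePoset

variable {m p d n : ℕ} {ζ : ℂ}

/-- The word of a maximal eigenspace. -/
noncomputable def word (h : EigenSetup m p d ζ)
    (E : {E : EigenspacePoset (monomialGroup m p n) ζ // IsMin E}) :
    EigenWord m n (cycleLength m d) (numDegreesDvd m p n d) :=
  (exists_isFullWordOf h E.2).choose

theorem word_spec (h : EigenSetup m p d ζ)
    (E : {E : EigenspacePoset (monomialGroup m p n) ζ // IsMin E}) :
    (word h E).IsFullWordOf ζ E.1.space :=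
  (exists_isFullWordOf h E.2).choose_spec

theorem word_injective (h : EigenSetup m p d ζ) : Function.Injective
    (word h : {E : EigenspacePoset (monomialGroup m p n) ζ // IsMin E} → _) := by
  intro E F hEF
  apply Subtype.ext
  apply space_injective
  rw [(word_spec h E).word.eq_space h.ne_one, (word_spec h F).word.eq_space h.ne_one, hEF]

/-- The comparison of eigenspaces by their words. -/
def WordLT (d : ℕ) (E E' : EigenspacePoset (monomialGroup m p n) ζ) : Prop :=
  ∃ w w' : EigenWord m n (cycleLength m d) (numDegreesDvd m p n d),
    w.IsWordOf ζ E.space ∧ w'.IsWordOf ζ E'.space ∧ w.LexLT w'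

theorem wordLT_iff (h : EigenSetup m p d ζ) {E E' : EigenspacePoset (monomialGroup m p n) ζ}
    (hE : IsMin E) (hE' : IsMin E') :
    WordLT d E E' ↔ (word h ⟨E, hE⟩).key < (word h ⟨E', hE'⟩).key := by
  rw [EigenWord.key_lt h.pos]
  constructor
  · rintro ⟨w, w', hw, hw', hlt⟩
    rwa [(isFullWordOf h hE hw).eq h (word_spec h ⟨E, hE⟩),
      (isFullWordOf h hE' hw').eq h (word_spec h ⟨E', hE'⟩)] at hlt
  · intro hlt
    exact ⟨_, _, (word_spec h ⟨E, hE⟩).word, (word_spec h ⟨E', hE'⟩).word, hlt⟩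

theorem WordLT.asymm (h : EigenSetup m p d ζ) {E E' : EigenspacePoset (monomialGroup m p n) ζ}
    (hE : IsMin E) (hE' : IsMin E') (h1 : WordLT d E E') : ¬ WordLT d E' E := by
  rw [wordLT_iff h hE hE'] at h1
  rw [wordLT_iff h hE' hE]
  exact lt_asymm h1

theorem exists_isLexListing (h : EigenSetup m p d ζ) :
    ∃ es : List (EigenspacePoset (monomialGroup m p n) ζ), IsLexListing m p n d ζ es := by
  classical
  have := finite (n := n) h
  have := Fintype.ofFinite {E : EigenspacePoset (monomialGroup m p n) ζ // IsMin E}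
  let r : {E : EigenspacePoset (monomialGroup m p n) ζ // IsMin E} →
    {E : EigenspacePoset (monomialGroup m p n) ζ // IsMin E} → Prop :=
    fun E F => (word h E).key ≤ (word h F).key
  have : Std.Total r := ⟨fun _ _ => le_total _ _⟩
  have : IsTrans _ r := ⟨fun _ _ _ => le_trans⟩
  let L := (Finset.univ.toList).insertionSort r
  have hL : ∀ E, E ∈ L := fun E => by simp [L]
  have hnd : L.Nodup := (List.perm_insertionSort r _).nodup_iff.mpr (Finset.nodup_toList _)
  refine ⟨L.map Subtype.val, fun E => ?_, ?_⟩
  · rw [List.mem_map]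
    exact ⟨by rintro ⟨F, -, rfl⟩; exact F.2, fun hE => ⟨⟨E, hE⟩, hL _, rfl⟩⟩
  · rw [List.pairwise_map]
    refine ((List.pairwise_insertionSort r _).and hnd).imp fun {E F} hEF => ?_
    refine (wordLT_iff h E.2 F.2).mpr (lt_of_le_of_ne hEF.1 fun heq => hEF.2 ?_)
    exact word_injective h (EigenWord.key_injective h.pos heq)

theorem _root_.IsLexListing.nodup (h : EigenSetup m p d ζ)
    {es : List (EigenspacePoset (monomialGroup m p n) ζ)} (hes : IsLexListing m p n d ζ es) :
    es.Nodup := by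
  refine hes.2.imp_of_mem fun {E F} hE hF hEF heq => ?_
  subst heq
  exact WordLT.asymm h ((hes.1 _).mp hE) ((hes.1 _).mp hE) hEF hEF

theorem _root_.IsLexListing.unique (h : EigenSetup m p d ζ)
    {es es' : List (EigenspacePoset (monomialGroup m p n) ζ)} (hes : IsLexListing m p n d ζ es)
    (hes' : IsLexListing m p n d ζ es') : es = es' := by
  refine List.Perm.eq_of_pairwise (le := WordLT d) (fun E F hE hF h1 h2 => ?_) hes.2 hes'.2 ?_
  · exact absurd h2 (h1.asymm h ((hes.1 _).mp hE) ((hes'.1 _).mp hF))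
  · rw [List.perm_ext_iff_of_nodup (hes.nodup h) (hes'.nodup h)]
    intro E
    rw [hes.1, hes'.1]

/-- The zero subspace. -/
def zero (h : EigenSetup m p d ζ) : EigenspacePoset (monomialGroup m p n) ζ :=
  ofSpace h (isMonomialEigenspace_bot h)

theorem le_zero (h : EigenSetup m p d ζ) (E : EigenspacePoset (monomialGroup m p n) ζ) :
    E ≤ zero h := le_iff.mpr bot_le

theorem not_bot_covBy_top (h : EigenSetup m p d ζ) :
    ¬ (⊥ : HatPoset (EigenspacePoset (monomialGroup m p n) ζ)) ⋖ ⊤ := fun hc =>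
  hc.2 (bot_lt_toHat (zero h)) (toHat_lt_top _)

theorem isGradedPoset (h : EigenSetup m p d ζ) :
    IsGradedPoset (HatPoset (EigenspacePoset (monomialGroup m p n) ζ)) := by
  let a := numDegreesDvd m p n d
  -- The rank is the codimension in a maximal eigenspace, shifted by one for the new bottom. The
  -- truncated subtraction is harmless by `finrank_le`, and the zero space, the only coatom, has
  -- rank a + 1.
  let r : HatPoset (EigenspacePoset (monomialGroup m p n) ζ) → ℕ := fun x =>
    WithBot.recBotCoe (C := fun _ => ℕ) 0 (fun y => WithTop.recTopCoe (C := fun _ => ℕ) (a + 2)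
      (fun E => a - Module.finrank ℂ E.space + 1) y) x
  have hr : ∀ E, r (toHat E) = a - Module.finrank ℂ E.space + 1 := fun E => rfl
  have hrt : r ⊤ = a + 2 := rfl
  refine ⟨r, rfl, fun x y hxy => ?_⟩
  rcases hat_cases x with rfl | rfl | ⟨E, rfl⟩
  · rcases hat_cases y with rfl | rfl | ⟨F, rfl⟩
    · exact absurd hxy.1 (lt_irrefl _)
    · exact absurd hxy (not_bot_covBy_top h)
    · rw [hr, finrank_of_isMin h (bot_covBy_toHat.mp hxy), Nat.sub_self]
      rfl
  · exact absurd hxy.1 not_top_lt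
  · rcases hat_cases y with rfl | rfl | ⟨F, rfl⟩
    · exact absurd hxy.1 not_lt_bot
    · rw [hr, hrt, (isMax_iff h).mp (toHat_covBy_top.mp hxy)]
      rfl
    · rw [hr, hr]
      have h1 := finrank_of_covBy h (toHat_covBy_toHat.mp hxy)
      have h2 := finrank_le h E
      change _ ≤ a at h2
      omega

theorem hat_semimodular (h : EigenSetup m p d ζ)
    (x : HatPoset (EigenspacePoset (monomialGroup m p n) ζ)) (hx : x ≠ ⊥)
    (a b : HatPoset (EigenspacePoset (monomialGroup m p n) ζ)) (ha : x ⋖ a) (hb : x ⋖ b)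
    (hab : a ≠ b) (y : HatPoset (EigenspacePoset (monomialGroup m p n) ζ)) (hay : a < y)
    (hby : b < y) : ∃ z, a ⋖ z ∧ b < z ∧ z ≤ y := by
  rcases hat_cases x with rfl | rfl | ⟨E, rfl⟩
  · exact absurd rfl hx
  · exact absurd ha.1 not_top_lt
  rcases hat_cases a with rfl | rfl | ⟨A, rfl⟩
  · exact absurd ha.1 not_lt_bot
  · exact absurd hay not_top_lt
  rcases hat_cases b with rfl | rfl | ⟨B, rfl⟩
  · exact absurd hb.1 not_lt_bot
  · exact absurd hby not_top_lt
  obtain ⟨C, hC, hBC, hmin⟩ := exists_covBy_of_covBy h (toHat_covBy_toHat.mp ha)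
    (toHat_covBy_toHat.mp hb) (fun heq => hab (by rw [heq]))
  refine ⟨toHat C, toHat_covBy_toHat.mpr hC, toHat_lt_toHat.mpr hBC, ?_⟩
  rcases hat_cases y with rfl | rfl | ⟨Y, rfl⟩
  · exact absurd hay not_lt_bot
  · exact le_top
  · exact toHat_le_toHat.mpr (hmin Y (toHat_lt_toHat.mp hay).le (toHat_lt_toHat.mp hby).le)

/-- Intervals above the atoms avoid the bottom, so `hat_semimodular` settles them for every
ordering; the word order enters only in the exchange condition. -/
theorem isRecursiveAtomOrdering (h : EigenSetup m p d ζ)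
    {es : List (EigenspacePoset (monomialGroup m p n) ζ)} (hes : IsLexListing m p n d ζ es) :
    IsRecursiveAtomOrdering (HatPoset (EigenspacePoset (monomialGroup m p n) ζ))
      (es.map toHat) := by
  have := finite (n := n) h
  have hfin : Finite (HatPoset (EigenspacePoset (monomialGroup m p n) ζ)) :=
    inferInstanceAs (Finite (Option (Option (EigenspacePoset (monomialGroup m p n) ζ))))
  refine ⟨hfin, isGradedPoset h, isRAOFrom_of_exchange bot_ne_top (not_bot_covBy_top h)
    ((hes.nodup h).map toHat_injective) (fun a => ?_) (fun a ha l' hl' hmem' => ?_)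
    fun i j hij y hiy hjy => ?_⟩
  · rw [List.mem_map]
    constructor
    · rintro ⟨E, hE, rfl⟩
      exact bot_covBy_toHat.mpr ((hes.1 E).mp hE)
    · intro ha
      rcases hat_cases a with rfl | rfl | ⟨E, rfl⟩
      · exact absurd ha.1 (lt_irrefl _)
      · exact absurd ha (not_bot_covBy_top h)
      · exact ⟨E, (hes.1 E).mpr (bot_covBy_toHat.mp ha), rfl⟩
  · obtain ⟨E, -, rfl⟩ := List.mem_map.mp ha
    refine isRAOFrom_of_semimodular {x | x ≠ ⊥} (fun x y hxy hx hy => hx (le_bot_iff.mp (hy ▸ hxy)))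
      (fun x hx => hat_semimodular h x hx) _ (bot_lt_toHat E).ne' (toHat_lt_top E).ne l' hl' hmem'
  · obtain ⟨i, hi⟩ := i
    obtain ⟨j, hj⟩ := j
    rw [List.length_map] at hi hj
    simp only [List.get_eq_getElem, List.getElem_map] at hiy hjy ⊢
    have hmini : IsMin es[i] := (hes.1 _).mp (List.getElem_mem hi)
    have hminj : IsMin es[j] := (hes.1 _).mp (List.getElem_mem hj)
    have hlt := List.pairwise_iff_getElem.mp hes.2 i j hi hj hij
    obtain ⟨v, w, hv, hw, hvw⟩ := hlt
    -- If y is the adjoined top, the zero subspace serves as the common upper bound.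
    obtain ⟨X, hXy, hiX, hjX⟩ : ∃ X, toHat X ≤ y ∧ es[i] ≤ X ∧ es[j] ≤ X := by
      rcases hat_cases y with rfl | rfl | ⟨Y, rfl⟩
      · exact absurd hiy not_lt_bot
      · exact ⟨zero h, le_top, le_zero h _, le_zero h _⟩
      · exact ⟨Y, le_rfl, (toHat_lt_toHat.mp hiy).le, (toHat_lt_toHat.mp hjy).le⟩
    have hw' := isFullWordOf h hminj hw
    obtain ⟨E', Y, hE', ⟨w', hw'', hlt'⟩, hcov, hE'Y, hYX⟩ := exists_exchange h hminj hw'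
      (isFullWordOf h hmini hv) hvw hjX hiX
    have hR : WordLT d E' es[j] := ⟨w', w, hw''.word, hw, hlt'⟩
    obtain ⟨k, hk, hkE⟩ := List.getElem_of_mem ((hes.1 E').mpr hE')
    -- The listing increases strictly with the words, so a smaller word means an earlier position.
    have hkj : k < j := by
      rcases lt_trichotomy k j with h1 | h1 | h1
      · exact h1
      · subst h1
        rw [← hkE] at hR
        exact absurd hR (hR.asymm h hminj hminj)
      · have h2 : WordLT d es[j] es[k] := List.pairwise_iff_getElem.mp hes.2 j k hj hk h1
        rw [hkE] at h2
        exact absurd h2 (hR.asymm h hE' hminj)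
    refine ⟨⟨k, by rwa [List.length_map]⟩, hkj, toHat Y, toHat_covBy_toHat.mpr hcov, ?_,
      (toHat_le_toHat.mpr hYX).trans hXy⟩
    rw [hkE]
    exact toHat_lt_toHat.mpr hE'Y

end EigenspacePoset

theorem theorem6p3 (m p n d : ℕ) (hm : 0 < m) (hp : p ∣ m) (hd : 1 < d)
    (ζ : ℂ) (hζ : IsPrimitiveRoot ζ d) :
    -- every maximal eigenspace has a unique word
    (∀ E : EigenspacePoset (monomialGroup m p n) ζ, IsMin E →
      ∃! w : EigenWord m n (cycleLength m d) (numDegreesDvd m p n d), w.IsWordOf ζ E.space) ∧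
    -- there is exactly one lexicographic listing of the maximal eigenspaces by their words
    (∃! es : List (EigenspacePoset (monomialGroup m p n) ζ), IsLexListing m p n d ζ es) ∧
    -- and it is a recursive atom ordering
    (∀ es : List (EigenspacePoset (monomialGroup m p n) ζ), IsLexListing m p n d ζ es →
      IsRecursiveAtomOrdering (HatPoset (EigenspacePoset (monomialGroup m p n) ζ))
        (es.map toHat)) := by
  have h : EigenSetup m p d ζ := ⟨hm, hp, hd, hζ⟩
  refine ⟨fun E hE => EigenspacePoset.existsUnique_isWordOf h hE, ?_,
    fun es hes => EigenspacePoset.isRecursiveAtomOrdering h hes⟩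
  obtain ⟨es, hes⟩ := EigenspacePoset.exists_isLexListing (n := n) h
  exact ⟨es, hes, fun es' hes' => hes'.unique h hes⟩
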